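/- For an integer $r\ge 1$ let $H^r(\mathbb Z)=\langle \alpha,\beta,\gamma \mid \alpha\beta\alpha^{-1}\beta^{-1}=\gamma^r,\ \alpha\gamma=\gamma\alpha,\ \beta\gamma=\gamma\beta\rangle$ be the discrete Heisenberg group. A discrete split oscillator group is a group isomorphic to a semidirect product $H^r(\mathbb Z)\rtimes_\phi \mathbb Z\delta$, for some $r\ge 1$, such that the map induced by $\phi(\delta)$ on $H^r(\mathbb Z)/Z(H^r(\mathbb Z))\cong\mathbb Z^2$ is conjugate in $\mathrm{GL}(2,\mathbb R)$ to a hyperbolic rotation, i.e. to an element of $SO^+(1,1)\setminus\{I_2\}$; let $T$ denote the trace of this induced map. For $B=\begin{pmatrix}a&b\\c&d\end{pmatrix}\in \mathrm{SL}(2,\mathbb Z)$ with $\operatorname{tr}B>2$ and $l=(l_1,l_2)\in\mathbb Z^2$ let $\mathrm{Osc}^r(B,l)=H^r(\mathbb Z)\rtimes_\phi\mathbb Z\delta$ be the group with $\phi(\delta)(\alpha)=\alpha^a\beta^c\gamma^{-l_2}$, $\phi(\delta)(\beta)=\alpha^b\beta^d\gamma^{l_1}$, $\phi(\delta)(\gamma)=\gamma$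 (up to isomorphism it depends on $l$ only modulo $r$). The number $T$ depends only on the isomorphism class of a discrete split oscillator group. The groups $\mathrm{Osc}^r(B,l)$, where $r$ runs through all positive integers and $(B,l)$ through the following list, form a complete system of representatives of the isomorphism classes of discrete split oscillator groups with $T\le 7$: each of them is a discrete split oscillator group with $T=\operatorname{tr}B\le 7$, every discrete split oscillator group with $T\le 7$ is isomorphic to one of them, and groups for different triples $(r,B,l)$ are not isomorphic. - $T=3$: $B=\begin{pmatrix}2&1\\1&1\end{pmatrix}$, with $l=(0,0)$. - $T=4$: $B=\begin{pmatrix}3&2\\1&1\end{pmatrix}$, with $l\in\{(0,0),(1,0)\}$ if $r$ is even, and $l=(0,0)$ if $r$ is odd. - $T=5$: $B=\begin{pmatrix}4&3\\1&1\end{pmatrix}$, with $l\in\{(0,0),(1,0)\}$ if $3\mid r$, and $l=(0,0)$ otherwise. - $T=6$: $B=\begin{pmatrix}5&4\\1&1\end{pmatrix}$, with $l\in\{(0,0),(1,0),(2,0)\}$ if $r\equiv0\pmod 4$, $l\in\{(0,0),(1,0)\}$ if $r\equiv 2\pmod 4$, and $l=(0,0)$ if $r$ is odd. - $T=6$: $B=\begin{pmatrix}5&2\\2&1\end{pmatrix}$,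 with $l\in\{(0,0),(1,0),(1,1)\}$ if $r$ is even, and $l=(0,0)$ if $r$ is odd. - $T=7$: $B=\begin{pmatrix}6&5\\1&1\end{pmatrix}$, with $l\in\{(0,0),(1,0),(2,0)\}$ if $5\mid r$, and $l=(0,0)$ otherwise. - $T=7$: $B=\begin{pmatrix}5&3\\3&2\end{pmatrix}$, with $l\in\{(0,0),(0,1)\}$ if $5\mid r$, and $l=(0,0)$ otherwise. -/

import Mathlib

open scoped Matrix

/-- The discrete Heisenberg group `H^r(ℤ)`, in normal form: the triple `(x, y, z)` stands for
`α ^ x * β ^ y * γ ^ z`, where `γ` is central and `α β α⁻¹ β⁻¹ = γ ^ r`.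
That this is the group presented by these relations is `DiscHeis.equivPresented`. -/
@[ext]
structure DiscHeis (r : ℕ) where
  x : ℤ
  y : ℤ
  z : ℤ

namespace DiscHeis

variable {r : ℕ}

instance : Mul (DiscHeis r) :=
  ⟨fun g h => ⟨g.x + h.x, g.y + h.y, g.z + h.z - r * (g.y * h.x)⟩⟩

instance : One (DiscHeis r) := ⟨⟨0, 0, 0⟩⟩

instance : Inv (DiscHeis r) := ⟨fun g => ⟨-g.x, -g.y, -g.z - r * (g.y * g.x)⟩⟩

@[simp] theorem mul_x (g h : DiscHeis r) : (g * h).x = g.x + h.x := rfl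
@[simp] theorem mul_y (g h : DiscHeis r) : (g * h).y = g.y + h.y := rfl
@[simp] theorem mul_z (g h : DiscHeis r) :
    (g * h).z = g.z + h.z - r * (g.y * h.x) := rfl
@[simp] theorem one_x : (1 : DiscHeis r).x = 0 := rfl
@[simp] theorem one_y : (1 : DiscHeis r).y = 0 := rfl
@[simp] theorem one_z : (1 : DiscHeis r).z = 0 := rfl
@[simp] theorem inv_x (g : DiscHeis r) : (g⁻¹).x = -g.x := rfl
@[simp] theorem inv_y (g : DiscHeis r) : (g⁻¹).y = -g.y := rfl
@[simp] theorem inv_z (g : DiscHeis r) : (g⁻¹).z = -g.z - r * (g.y * g.x) := rfl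

instance : Group (DiscHeis r) :=
  Group.ofLeftAxioms
    (fun a b c => by ext <;> simp <;> ring)
    (fun a => by ext <;> simp)
    (fun a => by ext <;> simp; ring)

/-- The generator `α`. -/
def α : DiscHeis r := ⟨1, 0, 0⟩
/-- The generator `β`. -/
def β : DiscHeis r := ⟨0, 1, 0⟩
/-- The central generator `γ`. -/
def γ : DiscHeis r := ⟨0, 0, 1⟩

/-- Powers in the discrete Heisenberg group; `t` is the binomial coefficient `n (n - 1) / 2`. -/
theorem zpow_eq (g : DiscHeis r) (n : ℤ) :
    g ^ n = ⟨n * g.x, n * g.y, n * g.z - r * (g.x * g.y * (n * (n - 1) / 2))⟩ := by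
  have step : ∀ m : ℤ, (m + 1) * (m + 1 - 1) / 2 = m * (m - 1) / 2 + m := by
    intro m
    rw [show (m + 1) * (m + 1 - 1) = m * (m - 1) + m * 2 by ring]
    exact Int.add_mul_ediv_right _ _ (by norm_num)
  induction n using Int.induction_on with
  | zero => ext <;> simp
  | succ n ih =>
    rw [zpow_add_one, ih]
    have h := step n
    ext <;> simp only [mul_x, mul_y, mul_z]
    · ring
    · ring
    · rw [h]; ring
  | pred n ih =>
    rw [zpow_sub_one, ih]
    have h := step (-(n : ℤ) - 1)
    rw [show -(n : ℤ) - 1 + 1 = -n by ring] at h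
    ext <;> simp only [mul_x, mul_y, mul_z, inv_x, inv_y, inv_z]
    · ring
    · ring
    · rw [h]; ring

theorem normal_form (g : DiscHeis r) : g = α ^ g.x * β ^ g.y * γ ^ g.z := by
  ext <;> simp [zpow_eq, α, β, γ]

/-- The relators of `⟨α, β, γ ∣ α β α⁻¹ β⁻¹ = γ ^ r, α γ = γ α, β γ = γ β⟩`. -/
def relators (r : ℕ) : Set (FreeGroup (Fin 3)) :=
  let a := FreeGroup.of 0
  let b := FreeGroup.of 1
  let c := FreeGroup.of 2
  {a * b * a⁻¹ * b⁻¹ * (c ^ r)⁻¹, a * c * (c * a)⁻¹, b * c * (c * b)⁻¹}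

theorem zpow_comm_of_rel {G : Type*} [Group G] {a b c : G}
    (h : a * b * a⁻¹ * b⁻¹ = c ^ r) (hac : Commute a c) (hbc : Commute b c) (x y : ℤ) :
    b ^ y * a ^ x = a ^ x * b ^ y * c ^ (-(r * (y * x)) : ℤ) := by
  have h1 : SemiconjBy a b (c ^ (r : ℤ) * b) := by
    rw [SemiconjBy, zpow_natCast, ← h]; group
  have h2 : a * b ^ y = c ^ ((r : ℤ) * y) * b ^ y * a := by
    have := h1.zpow_right y
    rw [((hbc.zpow_right (r : ℤ)).symm).mul_zpow, ← zpow_mul] at this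
    exact this
  have h3 : SemiconjBy (b ^ y) (c ^ ((r : ℤ) * y) * a) a := by
    rw [SemiconjBy, h2, ← mul_assoc, (hbc.zpow_zpow y ((r : ℤ) * y)).eq]
  have h4 := h3.zpow_right x
  rw [((hac.zpow_right ((r : ℤ) * y)).symm).mul_zpow, ← zpow_mul, SemiconjBy, ← mul_assoc,
    (hbc.zpow_zpow _ _).eq, mul_assoc] at h4
  rw [← h4, ← mul_assoc] 
  have h5 : Commute (b ^ y * a ^ x) (c ^ (-(r * (y * x)) : ℤ)) :=
    (hbc.zpow_zpow _ _).mul_left (hac.zpow_zpow _ _)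
  rw [mul_assoc _ (b ^ y), mul_assoc, h5.eq, ← mul_assoc, ← zpow_add]
  rw [show (r : ℤ) * y * x + -(r * (y * x)) = 0 by ring]
  simp

/-- The homomorphism out of `H^r(ℤ)` given by images of the generators obeying the relations. -/
def lift {G : Type*} [Group G] (a b c : G)
    (h : a * b * a⁻¹ * b⁻¹ = c ^ r) (hac : Commute a c) (hbc : Commute b c) :
    DiscHeis r →* G :=
  MonoidHom.mk' (fun g => a ^ g.x * b ^ g.y * c ^ g.z) fun g k => by
    have e := zpow_comm_of_rel h hac hbc k.x g.y
    have e1 : c ^ g.z * (a ^ k.x * b ^ k.y * c ^ k.z)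
        = a ^ k.x * b ^ k.y * c ^ k.z * c ^ g.z :=
      ((((hac.zpow_zpow _ _).mul_left (hbc.zpow_zpow _ _)).mul_left
        ((Commute.refl c).zpow_zpow _ _)).symm).eq
    have e2 : c ^ (-(r * (g.y * k.x)) : ℤ) * b ^ k.y
        = b ^ k.y * c ^ (-(r * (g.y * k.x)) : ℤ) := ((hbc.zpow_zpow _ _).symm).eq
    calc a ^ (g.x + k.x) * b ^ (g.y + k.y) * c ^ (g.z + k.z - r * (g.y * k.x))
        = a ^ g.x * a ^ k.x * b ^ g.y * (b ^ k.y * c ^ (-(r * (g.y * k.x)) : ℤ))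
            * c ^ k.z * c ^ g.z := by
          rw [zpow_add, zpow_add,
            show g.z + k.z - r * (g.y * k.x) = -(r * (g.y * k.x)) + k.z + g.z by ring,
            zpow_add, zpow_add]
          simp only [mul_assoc]
      _ = a ^ g.x * (b ^ g.y * a ^ k.x) * b ^ k.y * c ^ k.z * c ^ g.z := by
          rw [e, ← e2]; simp only [mul_assoc]
      _ = a ^ g.x * b ^ g.y * (c ^ g.z * (a ^ k.x * b ^ k.y * c ^ k.z)) := by
          rw [e1]; simp only [mul_assoc]
      _ = a ^ g.x * b ^ g.y * c ^ g.z * (a ^ k.x * b ^ k.y * c ^ k.z) := by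
          simp only [mul_assoc]

/-- `H^r(ℤ)` is the group presented by `relators r`. -/
theorem equivPresented (r : ℕ) :
    ∃ e : PresentedGroup (relators r) ≃* DiscHeis r,
      e (PresentedGroup.of 0) = α ∧ e (PresentedGroup.of 1) = β ∧
        e (PresentedGroup.of 2) = γ := by
  have hrel : ∀ w ∈ relators r, FreeGroup.lift ![(α : DiscHeis r), β, γ] w = 1 := by
    intro w hw
    have hγ : (γ : DiscHeis r) ^ r = ⟨0, 0, r⟩ := by
      rw [← zpow_natCast, zpow_eq]; ext <;> simp [γ]
    rcases hw with rfl | rfl | rfl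
    · simp only [map_mul, map_inv, map_pow, FreeGroup.lift_apply_of]
      simp only [Matrix.cons_val_zero, Matrix.cons_val_one, Matrix.cons_val, hγ]
      ext <;> simp [α, β]
    · simp only [map_mul, map_inv, FreeGroup.lift_apply_of]
      ext <;> simp [α, γ]
    · simp only [map_mul, map_inv, FreeGroup.lift_apply_of]
      ext <;> simp [β, γ]
  have one_of : ∀ w ∈ relators r, (PresentedGroup.mk (relators r) w) = 1 := fun w hw =>
    PresentedGroup.one_of_mem hw
  have hab : (PresentedGroup.of 0 * PresentedGroup.of 1 * (PresentedGroup.of 0)⁻¹ *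
      (PresentedGroup.of 1)⁻¹ : PresentedGroup (relators r)) = PresentedGroup.of 2 ^ r :=
    mul_inv_eq_one.1 (one_of _ (Or.inl rfl))
  have hac : Commute (PresentedGroup.of 0 : PresentedGroup (relators r))
      (PresentedGroup.of 2) := mul_inv_eq_one.1 (one_of _ (Or.inr (Or.inl rfl)))
  have hbc : Commute (PresentedGroup.of 1 : PresentedGroup (relators r))
      (PresentedGroup.of 2) := mul_inv_eq_one.1 (one_of _ (Or.inr (Or.inr rfl)))
  let F : PresentedGroup (relators r) →* DiscHeis r := PresentedGroup.toGroup hrel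
  let E := lift _ _ _ hab hac hbc
  have F0 : F (PresentedGroup.of 0) = α := PresentedGroup.toGroup.of hrel
  have F1 : F (PresentedGroup.of 1) = β := PresentedGroup.toGroup.of hrel
  have F2 : F (PresentedGroup.of 2) = γ := PresentedGroup.toGroup.of hrel
  have hFE : F.comp E = MonoidHom.id _ := by
    ext1 g
    show F (PresentedGroup.of 0 ^ g.x * PresentedGroup.of 1 ^ g.y * PresentedGroup.of 2 ^ g.z) = g
    rw [map_mul, map_mul, map_zpow, map_zpow, map_zpow, F0, F1, F2, ← normal_form]
  have hEF : E.comp F = MonoidHom.id _ := by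
    apply PresentedGroup.ext
    intro i
    fin_cases i
    · show E (F (PresentedGroup.of 0)) = PresentedGroup.of 0
      rw [F0]; simp [E, lift, α]
    · show E (F (PresentedGroup.of 1)) = PresentedGroup.of 1
      rw [F1]; simp [E, lift, β]
    · show E (F (PresentedGroup.of 2)) = PresentedGroup.of 2
      rw [F2]; simp [E, lift, γ]
  exact ⟨F.toMulEquiv E hEF hFE, F0, F1, F2⟩

/-- The image of `α` under the automorphism attached to `(B, l)`: for
`B = (a b; c d)` this is `α ^ a * β ^ c * γ ^ (-l₂)`. -/
def imα (r : ℕ) (B : Matrix.SpecialLinearGroup (Fin 2) ℤ) (l : Fin 2 → ℤ) : DiscHeis r :=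
  α ^ B 0 0 * β ^ B 1 0 * γ ^ (-l 1)

/-- The image of `β` under the automorphism attached to `(B, l)`: for
`B = (a b; c d)` this is `α ^ b * β ^ d * γ ^ l₁`. -/
def imβ (r : ℕ) (B : Matrix.SpecialLinearGroup (Fin 2) ℤ) (l : Fin 2 → ℤ) : DiscHeis r :=
  α ^ B 0 1 * β ^ B 1 1 * γ ^ l 0

theorem imα_eq (B : Matrix.SpecialLinearGroup (Fin 2) ℤ) (l : Fin 2 → ℤ) :
    imα r B l = ⟨B 0 0, B 1 0, -l 1⟩ := by
  ext <;> simp [imα, zpow_eq, α, β, γ]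

theorem imβ_eq (B : Matrix.SpecialLinearGroup (Fin 2) ℤ) (l : Fin 2 → ℤ) :
    imβ r B l = ⟨B 0 1, B 1 1, l 0⟩ := by
  ext <;> simp [imβ, zpow_eq, α, β, γ]

/-- The endomorphism of `H^r(ℤ)` with
`α ↦ α ^ a * β ^ c * γ ^ (-l₂)`, `β ↦ α ^ b * β ^ d * γ ^ l₁`, `γ ↦ γ`. -/
def hom (r : ℕ) (B : Matrix.SpecialLinearGroup (Fin 2) ℤ) (l : Fin 2 → ℤ) :
    DiscHeis r →* DiscHeis r :=
  lift (imα r B l) (imβ r B l) γ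
    (by
      have hγ : (γ : DiscHeis r) ^ r = ⟨0, 0, r⟩ := by
        rw [← zpow_natCast, zpow_eq]; ext <;> simp [γ]
      have hdet := B.det_coe
      rw [Matrix.det_fin_two] at hdet
      rw [hγ, imα_eq, imβ_eq]
      ext
      · simp
      · simp
      · simp only [mul_x, mul_y, mul_z, inv_x, inv_y, inv_z]
        linear_combination (r : ℤ) * hdet)
    (by show _ * _ = _ * _; ext <;> simp [γ]; ring)
    (by show _ * _ = _ * _; ext <;> simp [γ]; ring)

theorem hom_α (B : Matrix.SpecialLinearGroup (Fin 2) ℤ) (l : Fin 2 → ℤ) :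
    hom r B l α = α ^ B 0 0 * β ^ B 1 0 * γ ^ (-l 1) := by
  simp [hom, lift, α, imα]

theorem hom_β (B : Matrix.SpecialLinearGroup (Fin 2) ℤ) (l : Fin 2 → ℤ) :
    hom r B l β = α ^ B 0 1 * β ^ B 1 1 * γ ^ l 0 := by
  simp [hom, lift, β, imβ]

theorem hom_γ (B : Matrix.SpecialLinearGroup (Fin 2) ℤ) (l : Fin 2 → ℤ) :
    hom r B l γ = γ := by
  simp [hom, lift, γ]

theorem hom_x (B : Matrix.SpecialLinearGroup (Fin 2) ℤ) (l : Fin 2 → ℤ) (g : DiscHeis r) :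
    (hom r B l g).x = B 0 0 * g.x + B 0 1 * g.y := by
  simp [hom, lift, zpow_eq, imα_eq, imβ_eq, γ]; ring

theorem hom_y (B : Matrix.SpecialLinearGroup (Fin 2) ℤ) (l : Fin 2 → ℤ) (g : DiscHeis r) :
    (hom r B l g).y = B 1 0 * g.x + B 1 1 * g.y := by
  simp [hom, lift, zpow_eq, imα_eq, imβ_eq, γ]; ring

theorem hom_bijective (B : Matrix.SpecialLinearGroup (Fin 2) ℤ) (l : Fin 2 → ℤ) :
    Function.Bijective (hom r B l) := by
  have hdet := B.det_coe
  rw [Matrix.det_fin_two] at hdet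
  constructor
  · rw [injective_iff_map_eq_one]
    intro g hg
    have h1 : B 0 0 * g.x + B 0 1 * g.y = 0 := by rw [← hom_x B l g, hg]; rfl
    have h2 : B 1 0 * g.x + B 1 1 * g.y = 0 := by rw [← hom_y B l g, hg]; rfl
    have hx : g.x = 0 := by
      linear_combination B 1 1 * h1 - B 0 1 * h2 - g.x * hdet
    have hy : g.y = 0 := by
      linear_combination B 0 0 * h2 - B 1 0 * h1 - g.y * hdet
    have hz : (hom r B l g).z = g.z := by
      simp [hom, lift, hx, hy, zpow_eq, γ]
    rw [hg] at hz
    ext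
    · exact hx
    · exact hy
    · exact hz.symm
  · intro k
    let g : DiscHeis r := ⟨B 1 1 * k.x - B 0 1 * k.y, B 0 0 * k.y - B 1 0 * k.x, 0⟩
    refine ⟨g * γ ^ (k.z - (hom r B l g).z), ?_⟩
    rw [map_mul, map_zpow, hom_γ]
    ext
    · simp only [mul_x, hom_x, zpow_eq, γ, g]
      linear_combination k.x * hdet
    · simp only [mul_y, hom_y, zpow_eq, γ, g]
      linear_combination k.y * hdet
    · simp [zpow_eq, γ]

/-- The automorphism `φ(δ)` of `H^r(ℤ)` attached to `(B, l)`. -/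
noncomputable def aut (r : ℕ) (B : Matrix.SpecialLinearGroup (Fin 2) ℤ) (l : Fin 2 → ℤ) :
    MulAut (DiscHeis r) :=
  MulEquiv.ofBijective (hom r B l) (hom_bijective B l)

end DiscHeis

/-- `Osc^r(B, l) = H^r(ℤ) ⋊ ℤ δ`, where `δ` acts by `DiscHeis.aut r B l`. -/
abbrev Osc (r : ℕ) (B : Matrix.SpecialLinearGroup (Fin 2) ℤ) (l : Fin 2 → ℤ) : Type :=
  DiscHeis r ⋊[zpowersHom (MulAut (DiscHeis r)) (DiscHeis.aut r B l)] Multiplicative ℤ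

/-- `B` is the matrix, in some `ℤ`-basis of `H / Z(H) ≅ ℤ²`, of the map induced by `ψ`. -/
def IsInducedMatrix {H : Type*} [Group H] (ψ : MulAut H) (B : Matrix (Fin 2) (Fin 2) ℤ) :
    Prop :=
  ∃ e : (H ⧸ Subgroup.center H) ≃* Multiplicative (Fin 2 → ℤ),
    ∀ h : H, (e (QuotientGroup.mk (ψ h))).toAdd = B *ᵥ (e (QuotientGroup.mk h)).toAdd

/-- `B` is conjugate in `GL(2, ℝ)` to a hyperbolic rotation, that is, to an element of
`SO⁺(1, 1)`, different from the identity. -/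
def IsConjHyperbolicRotation (B : Matrix (Fin 2) (Fin 2) ℤ) : Prop :=
  ∃ (P : GL (Fin 2) ℝ) (s : ℝ), s ≠ 0 ∧
    B.map (Int.cast : ℤ → ℝ) = (P⁻¹ : GL (Fin 2) ℝ).val *
      !![Real.cosh s, Real.sinh s; Real.sinh s, Real.cosh s] * P.val

/-- `G` is a discrete split oscillator group whose generator `δ` induces on `H_d / Z(H_d)` a
map of trace `T`: it is isomorphic to a semidirect product `H_d ⋊ ℤ δ` with `H_d` a discrete
Heisenberg group on which `δ` induces, modulo the centre, a map that is conjugate to a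
nontrivial hyperbolic rotation. -/
def IsDiscreteSplitOscillatorGroup (G : Type*) [Group G] (T : ℤ) : Prop :=
  ∃ (r : ℕ) (φ : Multiplicative ℤ →* MulAut (DiscHeis r)) (B : Matrix (Fin 2) (Fin 2) ℤ),
    0 < r ∧ IsInducedMatrix (φ (Multiplicative.ofAdd 1)) B ∧ IsConjHyperbolicRotation B ∧
      B.trace = T ∧ Nonempty (G ≃* DiscHeis r ⋊[φ] Multiplicative ℤ)

/-- The table: the matrices `B` with `tr B ≤ 7` and, for each of them, the vectors `l`,
depending on `r`. -/
def InTable (r : ℕ) (B : Matrix.SpecialLinearGroup (Fin 2) ℤ) (l : Fin 2 → ℤ) : Prop :=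
  -- trace 3
  (B.val = !![2, 1; 1, 1] ∧ l = ![0, 0]) ∨
  -- trace 4
  (B.val = !![3, 2; 1, 1] ∧
    (r % 2 = 0 ∧ (l = ![0, 0] ∨ l = ![1, 0]) ∨
     r % 2 = 1 ∧ l = ![0, 0])) ∨
  -- trace 5
  (B.val = !![4, 3; 1, 1] ∧
    (r % 3 = 0 ∧ (l = ![0, 0] ∨ l = ![1, 0]) ∨
     r % 3 ≠ 0 ∧ l = ![0, 0])) ∨
  -- trace 6
  (B.val = !![5, 4; 1, 1] ∧
    (r % 4 = 0 ∧ (l = ![0, 0] ∨ l = ![1, 0] ∨ l = ![2, 0]) ∨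
     r % 4 = 2 ∧ (l = ![0, 0] ∨ l = ![1, 0]) ∨
     r % 2 = 1 ∧ l = ![0, 0])) ∨
  (B.val = !![5, 2; 2, 1] ∧
    (r % 2 = 0 ∧ (l = ![0, 0] ∨ l = ![1, 0] ∨ l = ![1, 1]) ∨
     r % 2 = 1 ∧ l = ![0, 0])) ∨
  -- trace 7
  (B.val = !![6, 5; 1, 1] ∧
    (r % 5 = 0 ∧ (l = ![0, 0] ∨ l = ![1, 0] ∨ l = ![2, 0]) ∨
     r % 5 ≠ 0 ∧ l = ![0, 0])) ∨
  (B.val = !![5, 3; 3, 2] ∧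
    (r % 5 = 0 ∧ (l = ![0, 0] ∨ l = ![0, 1]) ∨
     r % 5 ≠ 0 ∧ l = ![0, 0]))

/-! Read `l` as the covector `v ↦ det (l, v)` on `ℤ²`: it records the central part of `φ(δ)` on `α`
and `β`. The central coordinate `z` is additive modulo `r`, and inner automorphisms change it on the
two generators by arbitrary multiples of `r`. Hence, up to inner automorphisms, an automorphism of
`H^r(ℤ)` is a linear part `S ∈ GL₂(ℤ)` together with a covector `m` modulo `r`.

Since `det (A - 1) = 2 - tr A ≠ 0`, every homomorphism from the oscillator group to `ℤ` kills the
Heisenberg subgroup. An isomorphism therefore preserves that subgroup and sends `δ` to `δ^{±1}`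
times an element of it. So `r` is an invariant, `S A = B^{±1} S`, and the covectors of `l'` and `±l`
correspond under `S` modulo `r` and modulo the covectors `m (A - 1)` (`conj_of_osc_equiv`).
Conversely, such data with the sign `+` give an isomorphism (`osc_equiv_of_conj`).

Two finite problems remain. Gauss reduction leaves seven matrices with trace at most 7
(`GLConj.exists_representative`). For each of them, one needs the orbits on `ℤ² / ((A - 1) ℤ² + r
ℤ²)` of the `S` with `S A = A^{±1} S`. This quotient is `ℤ / gcd (n, r)` for the matrix `(n+1 n; 1
1)`, `(ℤ / gcd (2, r))²` for `(5 2; 2 1)` and `ℤ / gcd (5, r)` for `(5 3; 3 2)`. Orbits are joined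
by `-1` or by roots of `A`, and separated by congruences forced by `det S = ±1`. -/

namespace DiscHeis

variable {r : ℕ}

/-! ### Coordinates of homomorphisms between Heisenberg groups -/

theorem γ_zpow (n : ℤ) : (γ : DiscHeis r) ^ n = ⟨0, 0, n⟩ := by
  ext <;> simp [zpow_eq, γ]

theorem hom_ext_gen {G : Type*} [Group G] {f g : DiscHeis r →* G}
    (hα : f α = g α) (hβ : f β = g β) (hγ : f γ = g γ) : f = g := by
  ext h
  rw [normal_form h]
  simp only [map_mul, map_zpow, hα, hβ, hγ]

/-- Reduction modulo `r` of the central coordinate. -/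
def centralMod (r : ℕ) : DiscHeis r →* Multiplicative (ZMod r) :=
  MonoidHom.mk' (fun g => Multiplicative.ofAdd (g.z : ZMod r)) fun g h => by
    rw [← ofAdd_add]
    simp

theorem toAdd_centralMod (g : DiscHeis r) : (centralMod r g).toAdd = (g.z : ZMod r) := rfl

theorem toAdd_map {A : Type*} [AddCommGroup A] (f : DiscHeis r →* Multiplicative A)
    (g : DiscHeis r) :
    (f g).toAdd = g.x • (f α).toAdd + g.y • (f β).toAdd + g.z • (f γ).toAdd := by
  conv_lhs => rw [normal_form g]
  simp only [map_mul, map_zpow, toAdd_mul, toAdd_zpow]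

/-- The first coordinate, as a homomorphism. -/
def xHom (r : ℕ) : DiscHeis r →* Multiplicative ℤ :=
  MonoidHom.mk' (fun g => Multiplicative.ofAdd g.x) fun _ _ => rfl

/-- The second coordinate, as a homomorphism. -/
def yHom (r : ℕ) : DiscHeis r →* Multiplicative ℤ :=
  MonoidHom.mk' (fun g => Multiplicative.ofAdd g.y) fun _ _ => rfl

/-- The correction term in the product is a multiple of `r'`, so modulo `r'` the central coordinate
of an image depends linearly on the three coordinates. -/
theorem map_z {r r' : ℕ} (f : DiscHeis r →* DiscHeis r') (g : DiscHeis r) :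
    ((f g).z : ZMod r') = g.x * (f α).z + g.y * (f β).z + g.z * (f γ).z := by
  have := toAdd_map ((centralMod r').comp f) g
  simpa [toAdd_centralMod] using this

theorem map_x {r r' : ℕ} (f : DiscHeis r →* DiscHeis r') (g : DiscHeis r) :
    (f g).x = g.x * (f α).x + g.y * (f β).x + g.z * (f γ).x :=
  toAdd_map ((xHom r').comp f) g

theorem map_y {r r' : ℕ} (f : DiscHeis r →* DiscHeis r') (g : DiscHeis r) :
    (f g).y = g.x * (f α).y + g.y * (f β).y + g.z * (f γ).y :=
  toAdd_map ((yHom r').comp f) g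

/-- Inner automorphisms only move `z`, by `r` times a determinant. This is why central coordinates
matter only modulo `r`. -/
theorem conj_eq (k g : DiscHeis r) :
    k * g * k⁻¹ = ⟨g.x, g.y, g.z + r * (k.x * g.y - k.y * g.x)⟩ := by
  ext <;> simp
  ring

theorem hom_α_eq (B : Matrix.SpecialLinearGroup (Fin 2) ℤ) (l : Fin 2 → ℤ) :
    hom r B l α = ⟨B 0 0, B 1 0, -l 1⟩ := by
  rw [hom_α]; exact imα_eq B l

theorem hom_β_eq (B : Matrix.SpecialLinearGroup (Fin 2) ℤ) (l : Fin 2 → ℤ) :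
    hom r B l β = ⟨B 0 1, B 1 1, l 0⟩ := by
  rw [hom_β]; exact imβ_eq B l

theorem hom_z (B : Matrix.SpecialLinearGroup (Fin 2) ℤ) (l : Fin 2 → ℤ) (g : DiscHeis r) :
    ((hom r B l g).z : ZMod r) = g.z - g.x * l 1 + g.y * l 0 := by
  rw [map_z, hom_α_eq, hom_β_eq, hom_γ]
  simp [γ]; ring

theorem aut_apply (B : Matrix.SpecialLinearGroup (Fin 2) ℤ) (l : Fin 2 → ℤ) (g : DiscHeis r) :
    aut r B l g = hom r B l g := rfl

theorem commute_iff (hr : 0 < r) (g h : DiscHeis r) :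
    g * h = h * g ↔ g.x * h.y = g.y * h.x := by
  have hr' : (r : ℤ) ≠ 0 := by positivity
  constructor
  · intro e
    have := congrArg DiscHeis.z e
    simp only [mul_z] at this
    exact mul_left_cancel₀ hr' (by linarith)
  · intro e
    ext
    · simp [add_comm]
    · simp [add_comm]
    · simp only [mul_z]
      linear_combination (r : ℤ) * e

theorem mem_center_iff (hr : 0 < r) (g : DiscHeis r) :
    g ∈ Subgroup.center (DiscHeis r) ↔ g.x = 0 ∧ g.y = 0 := by
  rw [Subgroup.mem_center_iff]
  constructor
  · intro h
    have h1 := (commute_iff hr _ _).1 (h α)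
    have h2 := (commute_iff hr _ _).1 (h β)
    simp [α, β] at h1 h2
    exact ⟨h2.symm, h1⟩
  · rintro ⟨hx, hy⟩ h
    rw [commute_iff hr, hx, hy]; simp

/-- The endomorphism with linear part `S` and `γ ↦ γ ^ det S`. -/
def gl (r : ℕ) (S : Matrix (Fin 2) (Fin 2) ℤ) (m : Fin 2 → ℤ) : DiscHeis r →* DiscHeis r :=
  lift ⟨S 0 0, S 1 0, m 0⟩ ⟨S 0 1, S 1 1, m 1⟩ ⟨0, 0, S.det⟩
    (by
      rw [← zpow_natCast, zpow_eq, Matrix.det_fin_two]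
      ext
      · simp
      · simp
      · simp; ring)
    (by show _ * _ = _ * _; ext <;> simp; ring)
    (by show _ * _ = _ * _; ext <;> simp; ring)

theorem gl_α (S : Matrix (Fin 2) (Fin 2) ℤ) (m : Fin 2 → ℤ) :
    gl r S m α = ⟨S 0 0, S 1 0, m 0⟩ := by
  simp [gl, lift, α]

theorem gl_β (S : Matrix (Fin 2) (Fin 2) ℤ) (m : Fin 2 → ℤ) :
    gl r S m β = ⟨S 0 1, S 1 1, m 1⟩ := by
  simp [gl, lift, β]

theorem gl_γ (S : Matrix (Fin 2) (Fin 2) ℤ) (m : Fin 2 → ℤ) :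
    gl r S m γ = ⟨0, 0, S.det⟩ := by
  simp [gl, lift, γ]

/-- The condition on `S.det` says that it is `±1`, so `S.det` times the adjugate inverts the linear
part, and `γ` goes to `γ` or `γ⁻¹`. -/
theorem gl_bijective (S : Matrix (Fin 2) (Fin 2) ℤ) (hS : S.det * S.det = 1) (m : Fin 2 → ℤ) :
    Function.Bijective (gl r S m) := by
  have hx : ∀ g, (gl r S m g).x = S 0 0 * g.x + S 0 1 * g.y := by
    intro g; rw [map_x, gl_α, gl_β, gl_γ]; simp; ring
  have hy : ∀ g, (gl r S m g).y = S 1 0 * g.x + S 1 1 * g.y := by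
    intro g; rw [map_y, gl_α, gl_β, gl_γ]; simp; ring
  have hγ : ∀ n : ℤ, gl r S m (γ ^ n) = ⟨0, 0, n * S.det⟩ := by
    intro n; rw [map_zpow, gl_γ, zpow_eq]; ext <;> simp
  have hdet := Matrix.det_fin_two S
  set D := S.det
  constructor
  · rw [injective_iff_map_eq_one]
    intro g hg
    have h1 := hx g
    have h2 := hy g
    rw [hg] at h1 h2
    simp only [one_x, one_y] at h1 h2
    have x0 : g.x = 0 := by
      linear_combination (-g.x) * hS - D * S 1 1 * h1 + D * S 0 1 * h2 + D * g.x * hdet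
    have y0 : g.y = 0 := by
      linear_combination (-g.y) * hS - D * S 0 0 * h2 + D * S 1 0 * h1 + D * g.y * hdet
    have e : g = γ ^ g.z := by rw [γ_zpow]; ext <;> simp [x0, y0]
    rw [e, hγ] at hg
    have h3 : g.z * D = 0 := congrArg DiscHeis.z hg
    ext
    · exact x0
    · exact y0
    · show g.z = 0
      linear_combination D * h3 - g.z * hS
  · intro k
    let g : DiscHeis r := ⟨D * (S 1 1 * k.x - S 0 1 * k.y), D * (S 0 0 * k.y - S 1 0 * k.x), 0⟩
    -- The element `g` has the right image modulo the centre; a power of `γ` repairs the central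
    -- coordinate.
    refine ⟨g * γ ^ (D * (k.z - (gl r S m g).z)), ?_⟩
    rw [map_mul, hγ]
    ext
    · simp only [mul_x, hx, g]
      linear_combination k.x * hS - D * k.x * hdet
    · simp only [mul_y, hy, g]
      linear_combination k.y * hS - D * k.y * hdet
    · simp only [mul_z]
      linear_combination (k.z - (gl r S m g).z) * hS

end DiscHeis

/-! ### Building isomorphisms of oscillator groups -/

/-- An isomorphism of the normal factors that intertwines the two automorphisms up to an inner
automorphism extends to the semidirect products with `ℤ`. -/
theorem semidirect_equiv_of_intertwine {H K : Type*} [Group H] [Group K] (θ : MulAut H)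
    (θ' : MulAut K) (ψ : H ≃* K) (k : K) (h : ∀ x, ψ (θ x) = k * θ' (ψ x) * k⁻¹) :
    Nonempty (H ⋊[zpowersHom (MulAut H) θ] Multiplicative ℤ ≃*
      K ⋊[zpowersHom (MulAut K) θ'] Multiplicative ℤ) := by
  -- The intended image of the generator `δ`: conjugation by `d` on `K` is `θ'` followed by
  -- conjugation by `k`.
  let d : K ⋊[zpowersHom (MulAut K) θ'] Multiplicative ℤ := ⟨k, Multiplicative.ofAdd 1⟩
  have hθ : ∀ x : K, d * SemidirectProduct.inl x * d⁻¹ =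
      SemidirectProduct.inl (k * θ' x * k⁻¹) := by
    intro x
    rw [mul_inv_eq_iff_eq_mul]
    ext <;> simp [d, zpowersHom_apply]
  have hn : ∀ (n : ℤ) (x : H), SemidirectProduct.inl (ψ ((θ ^ n) x)) =
      d ^ n * SemidirectProduct.inl (ψ x) * (d ^ n)⁻¹ := by
    intro n
    induction n using Int.induction_on with
    | zero => simp
    | succ n ih =>
      intro x
      rw [add_comm, zpow_add, zpow_add, zpow_one, zpow_one, MulAut.mul_apply, h, ← hθ, ih]
      group
    | pred n ih =>
      intro x
      have e : (SemidirectProduct.inl (ψ (θ⁻¹ ((θ ^ (-(n : ℤ))) x))) :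
          K ⋊[zpowersHom (MulAut K) θ'] Multiplicative ℤ) =
          d⁻¹ * SemidirectProduct.inl (ψ ((θ ^ (-(n : ℤ))) x)) * d := by
        have := hθ (ψ (θ⁻¹ ((θ ^ (-(n : ℤ))) x)))
        rw [← h, MulAut.apply_inv_self] at this
        rw [← this]; group
      rw [sub_eq_add_neg, add_comm, zpow_add, zpow_add, zpow_neg_one, zpow_neg_one,
        MulAut.mul_apply, e, ih]
      group
  let F := SemidirectProduct.lift (φ := zpowersHom (MulAut H) θ)
    (SemidirectProduct.inl.comp ψ.toMonoidHom)
    (zpowersHom (K ⋊[zpowersHom (MulAut K) θ'] Multiplicative ℤ) d) (by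
      intro n
      ext1 x
      simpa [zpowersHom_apply, -map_zpow, ← map_zpow, MulAut.conj_apply] using hn n.toAdd x)
  have hF : ∀ g, F g = SemidirectProduct.inl (ψ g.left) * d ^ g.right.toAdd := fun g => rfl
  have hdr : ∀ n : ℤ, (d ^ n).right = Multiplicative.ofAdd n := by
    intro n
    have : (d ^ n).right = SemidirectProduct.rightHom (d ^ n) := rfl
    rw [this, map_zpow]
    simp [d, ← ofAdd_zsmul]
  have hFr : ∀ g, (F g).right = g.right := by
    intro g; rw [hF]; simp [hdr]
  refine ⟨MulEquiv.ofBijective F ⟨?_, ?_⟩⟩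
  · rw [injective_iff_map_eq_one]
    intro g hg
    have h1 : g.right = 1 := by rw [← hFr, hg]; rfl
    rw [hF, h1] at hg
    simp only [toAdd_one, zpow_zero, mul_one] at hg
    have h2 : ψ g.left = 1 := SemidirectProduct.inl_injective (hg.trans (map_one _).symm)
    ext
    · simpa using h2
    · simp [h1]
  · intro g
    refine ⟨⟨ψ.symm (g * (d ^ g.right.toAdd)⁻¹).left, g.right⟩, ?_⟩
    rw [hF]
    simp only [MulEquiv.apply_symm_apply]
    rw [← eq_mul_inv_iff_mul_eq]
    ext
    · simp
    · simp only [SemidirectProduct.mul_right, SemidirectProduct.inv_right, hdr]; simp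

/-- Matrices conjugate under `GL₂(ℤ)`, with vectors that correspond modulo `r` and modulo the
image of `A - 1`, give isomorphic groups. -/
theorem osc_equiv_of_conj {r : ℕ} {A B : Matrix.SpecialLinearGroup (Fin 2) ℤ} {l l' : Fin 2 → ℤ}
    (S : Matrix (Fin 2) (Fin 2) ℤ) (hS : S.det * S.det = 1) (h : S * A.val = B.val * S)
    (m : Fin 2 → ℤ)
    (h0 : (r : ℤ) ∣ (-l' 1 * S 0 0 + l' 0 * S 1 0) -
      (S.det * (-l 1) + (m 0 * (A 0 0 - 1) + m 1 * A 1 0)))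
    (h1 : (r : ℤ) ∣ (-l' 1 * S 0 1 + l' 0 * S 1 1) -
      (S.det * l 0 + (m 0 * A 0 1 + m 1 * (A 1 1 - 1)))) :
    Nonempty (Osc r A l ≃* Osc r B l') := by
  let ψ := MulEquiv.ofBijective (DiscHeis.gl r S m) (DiscHeis.gl_bijective S hS m)
  have e00 : S 0 0 * A 0 0 + S 0 1 * A 1 0 = B 0 0 * S 0 0 + B 0 1 * S 1 0 := by
    simpa [Matrix.mul_apply, Fin.sum_univ_two] using congrFun (congrFun h 0) 0
  have e01 : S 0 0 * A 0 1 + S 0 1 * A 1 1 = B 0 0 * S 0 1 + B 0 1 * S 1 1 := by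
    simpa [Matrix.mul_apply, Fin.sum_univ_two] using congrFun (congrFun h 0) 1
  have e10 : S 1 0 * A 0 0 + S 1 1 * A 1 0 = B 1 0 * S 0 0 + B 1 1 * S 1 0 := by
    simpa [Matrix.mul_apply, Fin.sum_univ_two] using congrFun (congrFun h 1) 0
  have e11 : S 1 0 * A 0 1 + S 1 1 * A 1 1 = B 1 0 * S 0 1 + B 1 1 * S 1 1 := by
    simpa [Matrix.mul_apply, Fin.sum_univ_two] using congrFun (congrFun h 1) 1
  -- It suffices that `f` and `g` differ by an inner automorphism: they agree modulo the centre and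
  -- on `γ`, and `h0`, `h1` make their `z` coordinates on `α`, `β` congruent modulo `r`.
  set f := (DiscHeis.gl r S m).comp (DiscHeis.hom r A l) with hf
  set g := (DiscHeis.hom r B l').comp (DiscHeis.gl r S m) with hg
  have hxα : (f DiscHeis.α).x = (g DiscHeis.α).x := by
    simp only [hf, hg, MonoidHom.comp_apply, DiscHeis.hom_α_eq, DiscHeis.hom_x, DiscHeis.gl_α]
    rw [DiscHeis.map_x, DiscHeis.gl_α, DiscHeis.gl_β, DiscHeis.gl_γ]; simp; linarith
  have hyα : (f DiscHeis.α).y = (g DiscHeis.α).y := by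
    simp only [hf, hg, MonoidHom.comp_apply, DiscHeis.hom_α_eq, DiscHeis.hom_y, DiscHeis.gl_α]
    rw [DiscHeis.map_y, DiscHeis.gl_α, DiscHeis.gl_β, DiscHeis.gl_γ]; simp; linarith
  have hxβ : (f DiscHeis.β).x = (g DiscHeis.β).x := by
    simp only [hf, hg, MonoidHom.comp_apply, DiscHeis.hom_β_eq, DiscHeis.hom_x, DiscHeis.gl_β]
    rw [DiscHeis.map_x, DiscHeis.gl_α, DiscHeis.gl_β, DiscHeis.gl_γ]; simp; linarith
  have hyβ : (f DiscHeis.β).y = (g DiscHeis.β).y := by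
    simp only [hf, hg, MonoidHom.comp_apply, DiscHeis.hom_β_eq, DiscHeis.hom_y, DiscHeis.gl_β]
    rw [DiscHeis.map_y, DiscHeis.gl_α, DiscHeis.gl_β, DiscHeis.gl_γ]; simp; linarith
  have hzα : (r : ℤ) ∣ (f DiscHeis.α).z - (g DiscHeis.α).z := by
    rw [← ZMod.intCast_zmod_eq_zero_iff_dvd] at h0 ⊢
    push_cast at h0 ⊢
    simp only [hf, hg, MonoidHom.comp_apply, DiscHeis.hom_α_eq, DiscHeis.hom_z, DiscHeis.gl_α]
    rw [DiscHeis.map_z, DiscHeis.gl_α, DiscHeis.gl_β, DiscHeis.gl_γ]; push_cast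
    linear_combination -h0
  have hzβ : (r : ℤ) ∣ (f DiscHeis.β).z - (g DiscHeis.β).z := by
    rw [← ZMod.intCast_zmod_eq_zero_iff_dvd] at h1 ⊢
    push_cast at h1 ⊢
    simp only [hf, hg, MonoidHom.comp_apply, DiscHeis.hom_β_eq, DiscHeis.hom_z, DiscHeis.gl_β]
    rw [DiscHeis.map_z, DiscHeis.gl_α, DiscHeis.gl_β, DiscHeis.gl_γ]; push_cast
    linear_combination -h1
  have hgγ : g DiscHeis.γ = ⟨0, 0, S.det⟩ := by
    have : (⟨0, 0, S.det⟩ : DiscHeis r) = DiscHeis.γ ^ S.det := (DiscHeis.γ_zpow _).symm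
    simp only [hg, MonoidHom.comp_apply, DiscHeis.gl_γ]
    rw [this, map_zpow, DiscHeis.hom_γ]
  have hfγ : f DiscHeis.γ = ⟨0, 0, S.det⟩ := by
    simp only [hf, MonoidHom.comp_apply, DiscHeis.hom_γ, DiscHeis.gl_γ]
  have hdg : ((g DiscHeis.α).x * (g DiscHeis.β).y - (g DiscHeis.α).y * (g DiscHeis.β).x) *
      S.det = 1 := by
    have hB := B.det_coe
    rw [Matrix.det_fin_two] at hB
    simp only [hg, MonoidHom.comp_apply, DiscHeis.hom_x, DiscHeis.hom_y, DiscHeis.gl_α,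
      DiscHeis.gl_β]
    have hD := Matrix.det_fin_two S
    linear_combination (S 0 0 * S 1 1 - S 0 1 * S 1 0) * S.det * hB + hS - S.det * hD
  obtain ⟨u, hu⟩ := hzα
  obtain ⟨w, hw⟩ := hzβ
  set D := S.det
  -- Cramer's rule: conjugation by `k` must add `r * u` to the central coordinate of `g α` and `r *
  -- w` to that of `g β`. The determinant of this system is a unit by `hdg`.
  let k : DiscHeis r := ⟨D * (u * -(g DiscHeis.β).x + w * (g DiscHeis.α).x),
    D * (u * -(g DiscHeis.β).y + w * (g DiscHeis.α).y), 0⟩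
  have key : f = (MulAut.conj k).toMonoidHom.comp g := by
    apply DiscHeis.hom_ext_gen
    · rw [MonoidHom.comp_apply]
      show _ = k * g DiscHeis.α * k⁻¹
      rw [DiscHeis.conj_eq]
      ext
      · exact hxα
      · exact hyα
      · simp only [k]; linear_combination hu - (r : ℤ) * u * hdg
    · rw [MonoidHom.comp_apply]
      show _ = k * g DiscHeis.β * k⁻¹
      rw [DiscHeis.conj_eq]
      ext
      · exact hxβ
      · exact hyβ
      · simp only [k]; linear_combination hw - (r : ℤ) * w * hdg
    · rw [MonoidHom.comp_apply]
      show _ = k * g DiscHeis.γ * k⁻¹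
      rw [DiscHeis.conj_eq, hgγ]
      refine hfγ.trans ?_
      ext <;> simp
  exact semidirect_equiv_of_intertwine _ _ ψ k fun x => DFunLike.congr_fun key x

/-! ### What an isomorphism of oscillator groups preserves -/

namespace DiscHeis

theorem mul_inl_mul_inv {H : Type*} [Group H] (θ : MulAut H)
    (g : H ⋊[zpowersHom (MulAut H) θ] Multiplicative ℤ) (h : H) :
    g * SemidirectProduct.inl h * g⁻¹ =
      SemidirectProduct.inl (g.left * (θ ^ g.right.toAdd) h * g.left⁻¹) := by
  rw [mul_inv_eq_iff_eq_mul]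
  ext <;> simp [zpowersHom_apply]

theorem commutator_α_β (r : ℕ) : (α * β * α⁻¹ * β⁻¹ : DiscHeis r) = γ ^ (r : ℤ) := by
  rw [γ_zpow]
  ext <;> simp [α, β]

/-- The power `γ ^ r` is a commutator, so `γ` is killed. The restriction to `ℤ²` is invariant under
`A`, hence killed by `A - 1`, which is invertible over `ℚ`. -/
theorem hom_int_eq_one {r : ℕ} (hr : 0 < r) {A : Matrix.SpecialLinearGroup (Fin 2) ℤ}
    (hA : A.val.trace ≠ 2) {l : Fin 2 → ℤ} (f : Osc r A l →* Multiplicative ℤ)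
    (h : DiscHeis r) : f (SemidirectProduct.inl h) = 1 := by
  let F : DiscHeis r →* Multiplicative ℤ := f.comp SemidirectProduct.inl
  have hF : ∀ g, F (hom r A l g) = F g := by
    intro g
    have := congrArg f (mul_inl_mul_inv (aut r A l)
      (SemidirectProduct.inr (Multiplicative.ofAdd 1)) g)
    rw [map_mul, map_mul, map_inv, mul_inv_cancel_comm] at this
    have e : f (SemidirectProduct.inl (aut r A l g)) = f (SemidirectProduct.inl g) := by
      simpa using this.symm
    exact e
  have hγ : (F γ).toAdd = 0 := by
    have := congrArg F (commutator_α_β r)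
    rw [map_mul, map_mul, map_mul, map_inv, map_inv, mul_inv_cancel_comm, mul_inv_cancel,
      map_zpow] at this
    have := congrArg Multiplicative.toAdd this
    rw [toAdd_zpow, toAdd_one, smul_eq_mul, eq_comm, mul_eq_zero] at this
    rcases this with h | h
    · omega
    · exact h
  have h1 := congrArg Multiplicative.toAdd (hF α)
  have h2 := congrArg Multiplicative.toAdd (hF β)
  rw [toAdd_map, hom_α_eq, hγ] at h1
  rw [toAdd_map, hom_β_eq, hγ] at h2
  have hdet := A.det_coe
  rw [Matrix.det_fin_two] at hdet
  rw [Matrix.trace_fin_two] at hA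
  simp only [smul_eq_mul, mul_zero, add_zero] at h1 h2
  have ht : A 0 0 + A 1 1 - 2 ≠ 0 := by intro e; apply hA; linarith
  -- The adjugate of `A - 1` turns the two invariance equations into `(tr A - 2) * F α = 0`, and
  -- likewise for `β`.
  have hα : (F α).toAdd = 0 := by
    refine (mul_eq_zero.1 ?_).resolve_left ht
    linear_combination (1 - A 1 1) * h1 + A 1 0 * h2 + (F α).toAdd * hdet
  have hβ : (F β).toAdd = 0 := by
    refine (mul_eq_zero.1 ?_).resolve_left ht
    linear_combination (1 - A 0 0) * h2 + A 0 1 * h1 + (F β).toAdd * hdet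
  have := toAdd_map F h
  rw [hα, hβ, hγ] at this
  have e : F h = 1 := by simpa using this
  exact e

theorem osc_equiv_right {r r' : ℕ} (hr : 0 < r) {A B : Matrix.SpecialLinearGroup (Fin 2) ℤ}
    (hA : A.val.trace ≠ 2) {l l' : Fin 2 → ℤ} (F : Osc r A l ≃* Osc r' B l') (h : DiscHeis r) :
    F (SemidirectProduct.inl h) = SemidirectProduct.inl (F (SemidirectProduct.inl h)).left := by
  have := hom_int_eq_one hr hA (SemidirectProduct.rightHom.comp F.toMonoidHom) h
  ext1
  · simp
  · exact this

/-- The isomorphism of Heisenberg groups induced by an isomorphism of oscillator groups. -/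
noncomputable def oscEquivLeft {r r' : ℕ} (hr : 0 < r) (hr' : 0 < r')
    {A B : Matrix.SpecialLinearGroup (Fin 2) ℤ} (hA : A.val.trace ≠ 2) (hB : B.val.trace ≠ 2)
    {l l' : Fin 2 → ℤ} (F : Osc r A l ≃* Osc r' B l') : DiscHeis r ≃* DiscHeis r' where
  toFun h := (F (SemidirectProduct.inl h)).left
  invFun h := (F.symm (SemidirectProduct.inl h)).left
  left_inv h := by
    dsimp only
    rw [← osc_equiv_right hr hA F, F.symm_apply_apply, SemidirectProduct.left_inl]
  right_inv h := by
    dsimp only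
    rw [← osc_equiv_right hr' hB F.symm, F.apply_symm_apply, SemidirectProduct.left_inl]
  map_mul' g h := by
    have h1 : (F (SemidirectProduct.inl g)).right = 1 := by
      rw [osc_equiv_right hr hA F]; rfl
    rw [map_mul, map_mul, SemidirectProduct.mul_left, h1, map_one, MulAut.one_apply]

/-- The elements `k` and `n` are the two components of `F δ`. Since `δ` on the other side is also
reached, `n` divides `1`. -/
theorem oscEquivLeft_intertwine {r r' : ℕ} (hr : 0 < r) (hr' : 0 < r')
    {A B : Matrix.SpecialLinearGroup (Fin 2) ℤ} (hA : A.val.trace ≠ 2) (hB : B.val.trace ≠ 2)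
    {l l' : Fin 2 → ℤ} (F : Osc r A l ≃* Osc r' B l') :
    ∃ (k : DiscHeis r') (n : ℤ), (n = 1 ∨ n = -1) ∧
      ∀ h, oscEquivLeft hr hr' hA hB F (aut r A l h) =
        k * (aut r' B l' ^ n) (oscEquivLeft hr hr' hA hB F h) * k⁻¹ := by
  set d : Osc r A l := SemidirectProduct.inr (Multiplicative.ofAdd 1) with hd
  have hinl : ∀ h, F (SemidirectProduct.inl h) =
      SemidirectProduct.inl (oscEquivLeft hr hr' hA hB F h) := osc_equiv_right hr hA F
  have hdpow : ∀ g : Osc r A l, g = SemidirectProduct.inl g.left * d ^ g.right.toAdd := by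
    intro g
    rw [hd, ← map_zpow, ← ofAdd_zsmul, smul_eq_mul, mul_one, ofAdd_toAdd,
      SemidirectProduct.inl_left_mul_inr_right]
  refine ⟨(F d).left, (F d).right.toAdd, ?_, fun h => ?_⟩
  · have e := congrArg SemidirectProduct.rightHom
      (F.apply_symm_apply (SemidirectProduct.inr (Multiplicative.ofAdd (1 : ℤ))))
    rw [hdpow (F.symm _), map_mul, hinl, map_mul, SemidirectProduct.rightHom_inl, one_mul,
      map_zpow, map_zpow, SemidirectProduct.rightHom_inr] at e
    have e := congrArg Multiplicative.toAdd e
    rw [toAdd_zpow, toAdd_ofAdd, smul_eq_mul] at e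
    exact Int.isUnit_iff.1 (IsUnit.of_mul_eq_one_right _ e)
  · have e := congrArg F (mul_inl_mul_inv (aut r A l) d h)
    rw [map_mul, map_mul, map_inv, hinl, mul_inl_mul_inv, hinl] at e
    have e := SemidirectProduct.inl_injective e
    rw [e]
    simp [hd]

/-- An isomorphism preserves the centre, which is generated by `γ`. -/
theorem equiv_γ {r r' : ℕ} (hr : 0 < r) (hr' : 0 < r') (ψ : DiscHeis r ≃* DiscHeis r') :
    ψ γ = γ ^ (ψ γ).z := by
  have hc : ψ γ ∈ Subgroup.center (DiscHeis r') := by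
    rw [Subgroup.mem_center_iff]
    intro g
    obtain ⟨h, rfl⟩ := ψ.surjective g
    rw [← map_mul, ← map_mul, (commute_iff hr h γ).2 (by simp [γ])]
  obtain ⟨hx, hy⟩ := (mem_center_iff hr' _).1 hc
  rw [γ_zpow]
  ext <;> simp [hx, hy]

/-- The first identity comes from applying `equiv_γ` to `ψ` and its inverse, the second from
applying `ψ` to `α β α⁻¹ β⁻¹ = γ ^ r`. -/
theorem equiv_det {r r' : ℕ} (hr : 0 < r) (hr' : 0 < r') (ψ : DiscHeis r ≃* DiscHeis r') :
    (ψ γ).z * (ψ γ).z = 1 ∧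
      r' * ((ψ α).x * (ψ β).y - (ψ β).x * (ψ α).y) = r * (ψ γ).z := by
  constructor
  · have h1 := equiv_γ hr hr' ψ
    have h2 := equiv_γ hr' hr ψ.symm
    have e : ψ.symm (ψ γ) = γ := ψ.symm_apply_apply _
    rw [h1, map_zpow, h2, ← zpow_mul, γ_zpow] at e
    have e := congrArg DiscHeis.z e
    rcases Int.isUnit_iff.1 (IsUnit.of_mul_eq_one_right _ e) with h | h <;> rw [h] <;> rfl
  · have e := congrArg ψ (commutator_α_β r)
    rw [map_mul, map_mul, map_mul, map_inv, map_inv, map_zpow, equiv_γ hr hr' ψ, ← zpow_mul,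
      γ_zpow] at e
    have e := congrArg DiscHeis.z e
    simp only [mul_z, inv_z, mul_y, inv_y, inv_x] at e
    linear_combination e

/-- By `equiv_det`, `r` is an integer multiple of `r'`; the inverse isomorphism gives the other
divisibility. Intrinsically, `r` is the index of the commutator subgroup in the centre. -/
theorem equiv_eq {r r' : ℕ} (hr : 0 < r) (hr' : 0 < r') (ψ : DiscHeis r ≃* DiscHeis r') :
    r = r' := by
  have key : ∀ {r r' : ℕ}, 0 < r → 0 < r' → (DiscHeis r ≃* DiscHeis r') → r' ∣ r := by
    intro r r' hr hr' ψ
    obtain ⟨h1, h2⟩ := equiv_det hr hr' ψ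
    rw [← Int.natCast_dvd_natCast]
    exact ⟨((ψ α).x * (ψ β).y - (ψ β).x * (ψ α).y) * (ψ γ).z, by
      linear_combination (-(r : ℤ)) * h1 - (ψ γ).z * h2⟩
  exact Nat.dvd_antisymm (key hr' hr ψ.symm) (key hr hr' ψ)

end DiscHeis

open DiscHeis in
/-- An isomorphism of oscillator groups forces the parameters `r` to agree and the matrices, with
their vectors, to be conjugate under `GL₂(ℤ)` up to inversion. -/
theorem conj_of_osc_equiv {r r' : ℕ} (hr : 0 < r) (hr' : 0 < r')
    {A B : Matrix.SpecialLinearGroup (Fin 2) ℤ} (hA : A.val.trace ≠ 2) (hB : B.val.trace ≠ 2)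
    {l l' : Fin 2 → ℤ} (F : Osc r A l ≃* Osc r' B l') :
    r = r' ∧ ∃ (S : Matrix (Fin 2) (Fin 2) ℤ) (m : Fin 2 → ℤ), S.det * S.det = 1 ∧
      ((S * A.val = B.val * S ∧
        (r : ℤ) ∣ (-l' 1 * S 0 0 + l' 0 * S 1 0) -
          (S.det * (-l 1) + (m 0 * (A 0 0 - 1) + m 1 * A 1 0)) ∧
        (r : ℤ) ∣ (-l' 1 * S 0 1 + l' 0 * S 1 1) -
          (S.det * l 0 + (m 0 * A 0 1 + m 1 * (A 1 1 - 1)))) ∨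
      (B.val * S * A.val = S ∧
        (r : ℤ) ∣ (-l' 1 * (S * A.val) 0 0 + l' 0 * (S * A.val) 1 0) +
          (S.det * (-l 1) + (m 0 * (A 0 0 - 1) + m 1 * A 1 0)) ∧
        (r : ℤ) ∣ (-l' 1 * (S * A.val) 0 1 + l' 0 * (S * A.val) 1 1) +
          (S.det * l 0 + (m 0 * A 0 1 + m 1 * (A 1 1 - 1))))) := by
  obtain ⟨k, n, hn, h⟩ := oscEquivLeft_intertwine hr hr' hA hB F
  set ψ := oscEquivLeft hr hr' hA hB F
  obtain rfl := equiv_eq hr hr' ψ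
  obtain ⟨hd1, hd2⟩ := equiv_det hr hr' ψ
  have hr0 : (r : ℤ) ≠ 0 := by positivity
  have hd3 := mul_left_cancel₀ hr0 hd2
  -- The columns of `S` are the images of `α` and `β` modulo the centre, and `m` holds their central
  -- coordinates.
  refine ⟨rfl, !![(ψ α).x, (ψ β).x; (ψ α).y, (ψ β).y], ![(ψ α).z, (ψ β).z], ?_, ?_⟩
  · rw [Matrix.det_fin_two_of, hd3, hd1]
  have hγ := equiv_γ hr hr' ψ
  have hγx : (ψ γ).x = 0 := by rw [hγ, γ_zpow]
  have hγy : (ψ γ).y = 0 := by rw [hγ, γ_zpow]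
  have mx : ∀ g, (ψ g).x = g.x * (ψ α).x + g.y * (ψ β).x := by
    intro g; simpa [hγx] using map_x ψ.toMonoidHom g
  have my : ∀ g, (ψ g).y = g.x * (ψ α).y + g.y * (ψ β).y := by
    intro g; simpa [hγy] using map_y ψ.toMonoidHom g
  have mz : ∀ g, ((ψ g).z : ZMod r) = g.x * (ψ α).z + g.y * (ψ β).z + g.z * (ψ γ).z :=
    fun g => map_z ψ.toMonoidHom g
  rcases hn with rfl | rfl
  · left
    rw [zpow_one] at h
    have hα := h α
    have hβ := h β
    rw [conj_eq, aut_apply, aut_apply, hom_α_eq] at hα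
    rw [conj_eq, aut_apply, aut_apply, hom_β_eq] at hβ
    have xα := congrArg DiscHeis.x hα
    have yα := congrArg DiscHeis.y hα
    have zα := congrArg (fun g => ((DiscHeis.z g : ℤ) : ZMod r)) hα
    have xβ := congrArg DiscHeis.x hβ
    have yβ := congrArg DiscHeis.y hβ
    have zβ := congrArg (fun g => ((DiscHeis.z g : ℤ) : ZMod r)) hβ
    dsimp only at xα yα zα xβ yβ zβ
    rw [mx ⟨A 0 0, A 1 0, -l 1⟩, hom_x] at xα
    rw [my ⟨A 0 0, A 1 0, -l 1⟩, hom_y] at yα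
    rw [mx ⟨A 0 1, A 1 1, l 0⟩, hom_x] at xβ
    rw [my ⟨A 0 1, A 1 1, l 0⟩, hom_y] at yβ
    rw [Int.cast_add, mz ⟨A 0 0, A 1 0, -l 1⟩, hom_z, Int.cast_mul, Int.cast_natCast,
      CharP.cast_eq_zero] at zα
    rw [Int.cast_add, mz ⟨A 0 1, A 1 1, l 0⟩, hom_z, Int.cast_mul, Int.cast_natCast,
      CharP.cast_eq_zero] at zβ
    dsimp only at xα yα zα xβ yβ zβ
    refine ⟨?_, ?_, ?_⟩
    · ext i j
      fin_cases i <;> fin_cases j <;> simp [Matrix.mul_apply, Fin.sum_univ_two] <;> linarith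
    · rw [← ZMod.intCast_zmod_eq_zero_iff_dvd, Matrix.det_fin_two_of, hd3]
      simp
      push_cast at zα
      linear_combination -zα
    · rw [← ZMod.intCast_zmod_eq_zero_iff_dvd, Matrix.det_fin_two_of, hd3]
      simp
      push_cast at zβ
      linear_combination -zβ
  · right
    -- The case `n = -1`: applying `aut r B l'` to both sides avoids coordinates for its inverse.
    -- Hence the form `B * S * A = S` of the second alternative.
    have h' : ∀ g, aut r B l' (k⁻¹ * ψ (aut r A l g) * k⁻¹⁻¹) = ψ g := by
      intro g
      rw [h, zpow_neg_one]
      have : k⁻¹ * (k * (aut r B l')⁻¹ (ψ g) * k⁻¹) * k⁻¹⁻¹ = (aut r B l')⁻¹ (ψ g) := by group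
      rw [this, MulAut.apply_inv_self]
    have hα := h' α
    have hβ := h' β
    rw [conj_eq, aut_apply, aut_apply, hom_α_eq] at hα
    rw [conj_eq, aut_apply, aut_apply, hom_β_eq] at hβ
    have xα := congrArg DiscHeis.x hα
    have yα := congrArg DiscHeis.y hα
    have zα := congrArg (fun g => ((DiscHeis.z g : ℤ) : ZMod r)) hα
    have xβ := congrArg DiscHeis.x hβ
    have yβ := congrArg DiscHeis.y hβ
    have zβ := congrArg (fun g => ((DiscHeis.z g : ℤ) : ZMod r)) hβ
    rw [hom_x, mx ⟨A 0 0, A 1 0, -l 1⟩, my ⟨A 0 0, A 1 0, -l 1⟩] at xα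
    rw [hom_y, mx ⟨A 0 0, A 1 0, -l 1⟩, my ⟨A 0 0, A 1 0, -l 1⟩] at yα
    rw [hom_x, mx ⟨A 0 1, A 1 1, l 0⟩, my ⟨A 0 1, A 1 1, l 0⟩] at xβ
    rw [hom_y, mx ⟨A 0 1, A 1 1, l 0⟩, my ⟨A 0 1, A 1 1, l 0⟩] at yβ
    rw [hom_z, Int.cast_add, mx ⟨A 0 0, A 1 0, -l 1⟩, my ⟨A 0 0, A 1 0, -l 1⟩,
      mz ⟨A 0 0, A 1 0, -l 1⟩, Int.cast_mul, Int.cast_natCast, CharP.cast_eq_zero] at zα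
    rw [hom_z, Int.cast_add, mx ⟨A 0 1, A 1 1, l 0⟩, my ⟨A 0 1, A 1 1, l 0⟩,
      mz ⟨A 0 1, A 1 1, l 0⟩, Int.cast_mul, Int.cast_natCast, CharP.cast_eq_zero] at zβ
    dsimp only at xα yα zα xβ yβ zβ
    refine ⟨?_, ?_, ?_⟩
    · ext i j
      fin_cases i <;> fin_cases j <;> simp [Matrix.mul_apply, Fin.sum_univ_two] <;> linarith
    · rw [← ZMod.intCast_zmod_eq_zero_iff_dvd, Matrix.det_fin_two_of, hd3]
      simp [Matrix.mul_apply, Fin.sum_univ_two]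
      push_cast at zα
      linear_combination zα
    · rw [← ZMod.intCast_zmod_eq_zero_iff_dvd, Matrix.det_fin_two_of, hd3]
      simp [Matrix.mul_apply, Fin.sum_univ_two]
      push_cast at zβ
      linear_combination zβ

/-! ### Reduction of hyperbolic matrices under `GL₂(ℤ)` -/

/-- Integral matrices conjugate under `GL₂(ℤ)`. -/
def GLConj (A B : Matrix (Fin 2) (Fin 2) ℤ) : Prop :=
  ∃ S : Matrix (Fin 2) (Fin 2) ℤ, S.det * S.det = 1 ∧ S * A = B * S

namespace GLConj

theorem refl (A : Matrix (Fin 2) (Fin 2) ℤ) : GLConj A A := ⟨1, by simp, by simp⟩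

theorem trans {A B C : Matrix (Fin 2) (Fin 2) ℤ} : GLConj A B → GLConj B C → GLConj A C := by
  rintro ⟨S, hS, h⟩ ⟨S', hS', h'⟩
  refine ⟨S' * S, ?_, ?_⟩
  · rw [Matrix.det_mul]; linear_combination hS * S'.det * S'.det + hS'
  · rw [Matrix.mul_assoc, h, ← Matrix.mul_assoc, h', Matrix.mul_assoc]

theorem trace_eq {A B : Matrix (Fin 2) (Fin 2) ℤ} : GLConj A B → A.trace = B.trace := by
  rintro ⟨S, hS, h⟩
  have hu : IsUnit S.det := IsUnit.of_mul_eq_one_right _ hS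
  have : A = S⁻¹ * (B * S) := by rw [← h, Matrix.nonsing_inv_mul_cancel_left _ _ hu]
  rw [this, Matrix.trace_mul_comm, Matrix.mul_nonsing_inv_cancel_right _ _ hu]

theorem det_eq {A B : Matrix (Fin 2) (Fin 2) ℤ} : GLConj A B → A.det = B.det := by
  rintro ⟨S, hS, h⟩
  have := congrArg Matrix.det h
  rw [Matrix.det_mul, Matrix.det_mul] at this
  linear_combination S.det * this + (B.det - A.det) * hS

/-- Conjugation by a translation. -/
theorem translate (a b c d k : ℤ) :
    GLConj !![a, b; c, d] !![a + k * c, b + k * (d - a) - k ^ 2 * c; c, d - k * c] := by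
  refine ⟨!![1, k; 0, 1], by simp [Matrix.det_fin_two_of], ?_⟩
  rw [Matrix.mul_fin_two, Matrix.mul_fin_two]
  ext i j; fin_cases i <;> fin_cases j <;> simp <;> ring

theorem swap (a b c d : ℤ) : GLConj !![a, b; c, d] !![d, c; b, a] := by
  refine ⟨!![0, 1; 1, 0], by simp [Matrix.det_fin_two_of], ?_⟩
  rw [Matrix.mul_fin_two, Matrix.mul_fin_two]
  ext i j; fin_cases i <;> fin_cases j <;> simp

theorem neg (a b c d : ℤ) : GLConj !![a, b; c, d] !![a, -b; -c, d] := by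
  refine ⟨!![1, 0; 0, -1], by simp [Matrix.det_fin_two_of], ?_⟩
  rw [Matrix.mul_fin_two, Matrix.mul_fin_two]
  ext i j; fin_cases i <;> fin_cases j <;> simp

/-- A hyperbolic matrix of determinant one is conjugate to one with small lower left entry. -/
theorem exists_reduced (A : Matrix (Fin 2) (Fin 2) ℤ) (hdet : A.det = 1) (hT : 2 < A.trace) :
    ∃ a b c d : ℤ, GLConj A !![a, b; c, d] ∧ 0 < c ∧ 4 * c ^ 2 ≤ A.trace ^ 2 - 4 ∧
      -c < a - d ∧ a - d ≤ c := by
  -- A triangular matrix of determinant one has trace `±2`.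
  have hne : ∀ a b c d : ℤ, GLConj A !![a, b; c, d] → c ≠ 0 := by
    rintro a b c d h rfl
    have h1 := h.trace_eq
    have h2 := h.det_eq
    rw [Matrix.trace_fin_two_of] at h1
    rw [Matrix.det_fin_two_of, hdet] at h2
    have : a * d = 1 := by linarith
    rcases Int.isUnit_iff.1 (IsUnit.of_mul_eq_one _ this) with rfl | rfl <;> omega
  -- Gauss reduction: the absolute value of the lower left entry is minimised over the conjugacy
  -- class.
  let P : ℕ → Prop := fun n => ∃ a b c d : ℤ, GLConj A !![a, b; c, d] ∧ c.natAbs = n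
  have hP : ∃ n, P n := ⟨_, A 0 0, A 0 1, A 1 0, A 1 1, by
    rw [← Matrix.eta_fin_two A]; exact refl A, rfl⟩
  classical
  have hmin : ∀ n, P n → Nat.find hP ≤ n := fun n => Nat.find_min' hP
  obtain ⟨a, b, c, d, hA, hc⟩ := Nat.find_spec hP
  have : ∃ a b c d : ℤ, GLConj A !![a, b; c, d] ∧ c.natAbs = Nat.find hP ∧ 0 < c := by
    rcases lt_or_gt_of_ne (hne _ _ _ _ hA) with h | h
    · exact ⟨a, -b, -c, d, hA.trans (neg a b c d), by omega, by omega⟩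
    · exact ⟨a, b, c, d, hA, hc, h⟩
  clear hc hA
  obtain ⟨a, b, c, d, hA, hc, hpos⟩ := this
  -- translate so that `a - d` lies in `(-c, c]`
  obtain ⟨k, hk1, hk2⟩ : ∃ k : ℤ, -c < a - d + 2 * k * c ∧ a - d + 2 * k * c ≤ c := by
    refine ⟨-((a - d + c - 1) / (2 * c)), ?_⟩
    have h1 := Int.emod_add_mul_ediv (a - d + c - 1) (2 * c)
    have h2 := Int.emod_nonneg (a - d + c - 1) (show 2 * c ≠ 0 by omega)
    have h3 := Int.emod_lt_of_pos (a - d + c - 1) (show 0 < 2 * c by omega)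
    constructor <;> nlinarith
  have hB := hA.trans (translate a b c d k)
  obtain ⟨a', ha⟩ : ∃ a', a' = a + k * c := ⟨_, rfl⟩
  obtain ⟨b', hb⟩ : ∃ b', b' = b + k * (d - a) - k ^ 2 * c := ⟨_, rfl⟩
  obtain ⟨d', hd⟩ : ∃ d', d' = d - k * c := ⟨_, rfl⟩
  rw [← ha, ← hb, ← hd] at hB
  have e1 : -c < a' - d' := by rw [ha, hd]; linarith
  have e2 : a' - d' ≤ c := by rw [ha, hd]; linarith
  refine ⟨a', b', c, d', hB, hpos, ?_, e1, e2⟩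
  -- Swapping the basis vectors puts `b'` in the lower left corner, so minimality gives `|b'| ≥ c`.
  have hswap : (Nat.find hP) ≤ b'.natAbs := hmin _ ⟨_, _, _, _, hB.trans (swap _ _ _ _), rfl⟩
  have h1 := hB.trace_eq
  have h2 := hB.det_eq
  rw [Matrix.trace_fin_two_of] at h1
  rw [Matrix.det_fin_two_of, hdet] at h2
  have hsq : (a' - d') ^ 2 ≤ c ^ 2 := sq_le_sq' (by linarith) (by linarith)
  have hT4 : 4 < A.trace ^ 2 := by nlinarith
  -- The identity `T² - 4 = (a' - d')² + 4 b' c` excludes `b' ≤ -c`, where the right side would be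
  -- negative; so `b' ≥ c` and `T² - 4 ≥ 4 c²`.
  have hcb : c ≤ b' ∨ c ≤ -b' := by omega
  rcases hcb with h | h
  · rw [h1]; nlinarith [sq_nonneg (a' - d')]
  · rw [h1] at hT4; exfalso; nlinarith [sq_nonneg (a' - d')]

/-- Representatives of the conjugacy classes of hyperbolic matrices of trace at most seven. -/
theorem exists_representative (A : Matrix (Fin 2) (Fin 2) ℤ) (hdet : A.det = 1)
    (hT : 2 < A.trace) (hT7 : A.trace ≤ 7) :
    GLConj A !![2, 1; 1, 1] ∨ GLConj A !![3, 2; 1, 1] ∨ GLConj A !![4, 3; 1, 1] ∨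
      GLConj A !![5, 4; 1, 1] ∨ GLConj A !![5, 2; 2, 1] ∨ GLConj A !![6, 5; 1, 1] ∨
      GLConj A !![5, 3; 3, 2] := by
  obtain ⟨a, b, c, d, hA, hc, hc2, h1, h2⟩ := exists_reduced A hdet hT
  have e1 := hA.trace_eq
  have e2 := hA.det_eq
  rw [Matrix.trace_fin_two_of] at e1
  rw [Matrix.det_fin_two_of, hdet] at e2
  have hc3 : c ≤ 3 := by nlinarith
  have key : ∀ k : ℤ, GLConj A !![a + k * c, b + k * (d - a) - k ^ 2 * c; c, d - k * c] :=
    fun k => hA.trans (translate a b c d k)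
  -- This translation makes the lower right entry `1` when `c = 1`, which leaves only `(T-1 T-2; 1
  -- 1)`.
  have kk := key (d - 1)
  generalize A.trace = T at *
  have hdT : d = T - a := by linarith
  subst hdT
  interval_cases c
  · have hb : b = a * (T - a) - 1 := by linarith
    subst hb
    have : GLConj A !![T - 1, T - 2; 1, 1] := by
      convert kk using 2
      ext i j; fin_cases i <;> fin_cases j <;> simp <;> ring
    interval_cases T <;> simp only [Int.reduceSub] at this <;> tauto
  · have k1 := key 1
    have ha : a ≤ 4 := by omega
    have ha' : 0 ≤ a := by omega
    -- For `c = 2` the determinant and the bounds leave only `(3 4; 2 3)`, which `k1` carries to `(5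
    -- 2; 2 1)`. For `c = 3` below, only `(5 3; 3 2)` itself survives.
    interval_cases T <;> interval_cases a <;> first | omega | skip
    all_goals
      obtain rfl : b = 4 := by omega
      norm_num at k1
      tauto
  · have k1 := key 1
    have ha : a ≤ 6 := by omega
    have ha' : 0 ≤ a := by omega
    interval_cases T <;> interval_cases a <;> first | omega | skip
    all_goals
      obtain rfl : b = 3 := by omega
      norm_num at k1 hA
      tauto

end GLConj

/-! ### Induced matrices, hyperbolic rotations and the form `Osc r A l` -/

namespace DiscHeis

/-- The quotient of the discrete Heisenberg group by its centre. -/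
theorem exists_quotient_center_equiv {r : ℕ} (hr : 0 < r) :
    ∃ e : (DiscHeis r ⧸ Subgroup.center (DiscHeis r)) ≃* Multiplicative (Fin 2 → ℤ),
      ∀ h : DiscHeis r, (e (QuotientGroup.mk h)).toAdd = ![h.x, h.y] := by
  let f : DiscHeis r →* Multiplicative (Fin 2 → ℤ) :=
    MonoidHom.mk' (fun g => Multiplicative.ofAdd ![g.x, g.y]) fun g h => by
      rw [← ofAdd_add]; simp
  have hf : ∀ g, (f g).toAdd = ![g.x, g.y] := fun _ => rfl
  have hs : Function.Surjective f := fun v => ⟨⟨v.toAdd 0, v.toAdd 1, 0⟩, by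
    apply Multiplicative.toAdd.injective
    rw [hf]
    ext i; fin_cases i <;> rfl⟩
  have hk : Subgroup.center (DiscHeis r) = f.ker := by
    ext g
    rw [mem_center_iff hr, MonoidHom.mem_ker, ← toAdd_eq_zero, hf]
    simp
  exact ⟨(QuotientGroup.quotientMulEquivOfEq hk).trans
    (QuotientGroup.quotientKerEquivOfSurjective f hs), fun h => rfl⟩

theorem isInducedMatrix_aut {r : ℕ} (hr : 0 < r) (B : Matrix.SpecialLinearGroup (Fin 2) ℤ)
    (l : Fin 2 → ℤ) : IsInducedMatrix (aut r B l) B.val := by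
  obtain ⟨e, he⟩ := exists_quotient_center_equiv hr
  refine ⟨e, fun h => ?_⟩
  rw [he, he, aut_apply, hom_x, hom_y]
  ext i; fin_cases i <;> simp [Matrix.mulVec, dotProduct, Fin.sum_univ_two]

/-- Any identification of `H / Z(H)` with `ℤ²` differs from the coordinates `(x, y)` by the matrix
whose columns are the images of `α` and `β`; surjectivity makes it unimodular. -/
theorem glConj_of_isInducedMatrix {r : ℕ} (hr : 0 < r) {ψ : MulAut (DiscHeis r)}
    {B : Matrix (Fin 2) (Fin 2) ℤ} (h : IsInducedMatrix ψ B) :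
    GLConj !![(ψ α).x, (ψ β).x; (ψ α).y, (ψ β).y] B := by
  obtain ⟨e, he⟩ := h
  let f : DiscHeis r →* Multiplicative (Fin 2 → ℤ) := e.toMonoidHom.comp (QuotientGroup.mk' _)
  have hfe : ∀ h, f h = e (QuotientGroup.mk h) := fun _ => rfl
  have hγ : f γ = 1 := by
    rw [hfe, (QuotientGroup.eq_one_iff _).2 ((mem_center_iff hr γ).2 ⟨rfl, rfl⟩), map_one]
  have hf : ∀ h : DiscHeis r, (f h).toAdd = h.x • (f α).toAdd + h.y • (f β).toAdd := by
    intro h; rw [toAdd_map, hγ]; simp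
  have hB : ∀ h, (f (ψ h)).toAdd = B *ᵥ (f h).toAdd := he
  have hs : Function.Surjective f := e.surjective.comp (QuotientGroup.mk'_surjective _)
  obtain ⟨u, hu⟩ := hs (Multiplicative.ofAdd ![1, 0])
  obtain ⟨v, hv⟩ := hs (Multiplicative.ofAdd ![0, 1])
  have hu' := hf u
  have hv' := hf v
  rw [hu, toAdd_ofAdd] at hu'
  rw [hv, toAdd_ofAdd] at hv'
  have hα := hB α
  have hβ := hB β
  rw [hf] at hα hβ
  set a := (f α).toAdd
  set b := (f β).toAdd
  have u0 := congrFun hu' 0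
  have u1 := congrFun hu' 1
  have v0 := congrFun hv' 0
  have v1 := congrFun hv' 1
  have a0 := congrFun hα 0
  have a1 := congrFun hα 1
  have b0 := congrFun hβ 0
  have b1 := congrFun hβ 1
  simp [Matrix.mulVec, dotProduct, Fin.sum_univ_two] at u0 u1 v0 v1 a0 a1 b0 b1
  refine ⟨!![a 0, b 0; a 1, b 1], ?_, ?_⟩
  · rw [Matrix.det_fin_two_of]
    have : (a 0 * b 1 - b 0 * a 1) * (u.x * v.y - u.y * v.x) = 1 := by
      have : (a 0 * b 1 - b 0 * a 1) * (u.x * v.y - u.y * v.x) =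
          (u.x * a 0 + u.y * b 0) * (v.x * a 1 + v.y * b 1) -
          (u.x * a 1 + u.y * b 1) * (v.x * a 0 + v.y * b 0) := by ring
      rw [this, ← u0, ← u1, ← v0, ← v1]; norm_num
    rcases Int.isUnit_iff.1 (IsUnit.of_mul_eq_one _ this) with h | h <;> rw [h] <;> rfl
  · ext i j
    fin_cases i <;> fin_cases j <;> simp [Matrix.mul_apply, Fin.sum_univ_two] <;> linarith

theorem eq_aut {r : ℕ} {ψ : MulAut (DiscHeis r)} (hγ : ψ γ = γ)
    (A : Matrix.SpecialLinearGroup (Fin 2) ℤ)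
    (hA : A.val = !![(ψ α).x, (ψ β).x; (ψ α).y, (ψ β).y]) :
    ψ = aut r A ![(ψ β).z, -(ψ α).z] := by
  have : ψ.toMonoidHom = hom r A ![(ψ β).z, -(ψ α).z] := by
    apply hom_ext_gen
    · rw [hom_α_eq]; ext <;> simp [hA]
    · rw [hom_β_eq]; ext <;> simp [hA]
    · rw [hom_γ]; exact hγ
  ext1 g
  exact DFunLike.congr_fun this g

end DiscHeis

/-- Determinant and trace can be read off the rotation: `cosh² s - sinh² s = 1` and `2 cosh s > 2`.
-/
theorem IsConjHyperbolicRotation.det_trace {B : Matrix (Fin 2) (Fin 2) ℤ}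
    (h : IsConjHyperbolicRotation B) : B.det = 1 ∧ 2 < B.trace := by
  obtain ⟨P, s, hs, h⟩ := h
  constructor
  · have h1 := congrArg Matrix.det h
    rw [Matrix.det_mul, Matrix.det_mul_comm, ← Matrix.det_mul, mul_assoc,
      ← Units.val_mul, inv_mul_cancel, Units.val_one, mul_one, Matrix.det_fin_two_of] at h1
    have h2 : ((B.det : ℤ) : ℝ) = 1 := by
      have : ((B.det : ℤ) : ℝ) = (B.map (Int.cast : ℤ → ℝ)).det := by
        rw [Matrix.det_fin_two, Matrix.det_fin_two]; simp
      rw [this, h1]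
      linear_combination Real.cosh_sq s
    exact_mod_cast h2
  · have h1 := congrArg Matrix.trace h
    rw [Matrix.trace_mul_comm, ← mul_assoc, ← Units.val_mul, mul_inv_cancel, Units.val_one,
      one_mul, Matrix.trace_fin_two_of] at h1
    have h2 : ((B.trace : ℤ) : ℝ) = (B.map (Int.cast : ℤ → ℝ)).trace := by
      rw [Matrix.trace_fin_two, Matrix.trace_fin_two]; simp
    have h3 := Real.one_lt_cosh.2 hs
    have : (2 : ℝ) < (B.trace : ℤ) := by rw [h2, h1]; linarith
    exact_mod_cast this

theorem isConjHyperbolicRotation_of_trace {B : Matrix (Fin 2) (Fin 2) ℤ} (hdet : B.det = 1)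
    (ht : 2 < B.trace) (hb : B 0 1 ≠ 0) : IsConjHyperbolicRotation B := by
  have ht' : (1 : ℝ) < (B.trace : ℝ) / 2 := by
    have : (2 : ℝ) < (B.trace : ℤ) := by exact_mod_cast ht
    linarith
  set s := Real.arcosh ((B.trace : ℝ) / 2) with hs
  have hc : Real.cosh s = (B.trace : ℝ) / 2 := Real.cosh_arcosh ht'.le
  have hs0 : 0 < s := Real.arcosh_pos ht'
  have hsh : Real.sinh s ≠ 0 := (Real.sinh_pos_iff.2 hs0).ne'
  have hsq := Real.cosh_sq s
  have hb' : (B 0 1 : ℝ) ≠ 0 := by exact_mod_cast hb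
  have hdet' : (B 0 0 * B 1 1 - B 0 1 * B 1 0 : ℝ) = 1 := by
    rw [Matrix.det_fin_two] at hdet; exact_mod_cast hdet
  have htr : 2 * Real.cosh s = B 0 0 + B 1 1 := by
    rw [hc, Matrix.trace_fin_two]; push_cast; ring
  -- With first row `(1, 0)`, the second row is forced by the first row of `P B = R P`, where `R` is
  -- the rotation. Then `B 0 1 ≠ 0` makes `P` invertible.
  let P : Matrix (Fin 2) (Fin 2) ℝ :=
    !![1, 0; (B 0 0 - Real.cosh s) / Real.sinh s, B 0 1 / Real.sinh s]
  have hP : P.det ≠ 0 := by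
    simp only [P, Matrix.det_fin_two_of]
    simp [hb', hsh]
  refine ⟨Matrix.GeneralLinearGroup.mkOfDetNeZero P hP, s, hs0.ne', ?_⟩
  rw [mul_assoc, ← Units.mul_right_inj (Matrix.GeneralLinearGroup.mkOfDetNeZero P hP), ← mul_assoc,
    ← Units.val_mul, mul_inv_cancel, Units.val_one, one_mul]
  show P * _ = _ * P
  have h11 : (B 1 1 : ℝ) = 2 * Real.cosh s - B 0 0 := by linarith
  ext i j
  fin_cases i <;> fin_cases j <;> simp [P, Matrix.mul_apply, Fin.sum_univ_two] <;> field_simp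
  · ring
  · rw [h11] at hdet'
    linear_combination hsq - hdet'
  · linarith

/-- A discrete split oscillator group is of the form `Osc r A l`. -/
theorem IsDiscreteSplitOscillatorGroup.exists_osc {G : Type*} [Group G] {T : ℤ}
    (h : IsDiscreteSplitOscillatorGroup G T) :
    ∃ (r : ℕ) (A : Matrix.SpecialLinearGroup (Fin 2) ℤ) (l : Fin 2 → ℤ),
      0 < r ∧ A.val.trace = T ∧ 2 < T ∧ Nonempty (G ≃* Osc r A l) := by
  obtain ⟨r, φ, B, hr, hB, hyp, hT, hG⟩ := h
  obtain ⟨hdet, htr⟩ := hyp.det_trace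
  obtain ⟨ψ, rfl⟩ := (zpowersHom (MulAut (DiscHeis r))).surjective φ
  have hψ : zpowersHom (MulAut (DiscHeis r)) ψ (Multiplicative.ofAdd 1) = ψ := by
    simp [zpowersHom_apply]
  rw [hψ] at hB
  have hconj := DiscHeis.glConj_of_isInducedMatrix hr hB
  have hA := hconj.det_eq.trans hdet
  -- The automorphism raises `γ` to the determinant of its linear part, which here is `1`.
  have hγz : (ψ DiscHeis.γ).z = 1 := by
    obtain ⟨-, h2⟩ := DiscHeis.equiv_det hr hr ψ
    have h3 := mul_left_cancel₀ (show (r : ℤ) ≠ 0 by positivity) h2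
    rw [Matrix.det_fin_two_of] at hA
    linarith
  have hγ : ψ DiscHeis.γ = DiscHeis.γ := by
    rw [DiscHeis.equiv_γ hr hr ψ, hγz, zpow_one]
  have e := DiscHeis.eq_aut hγ ⟨_, hA⟩ rfl
  refine ⟨r, ⟨_, hA⟩, ![(ψ DiscHeis.β).z, -(ψ DiscHeis.α).z], hr, ?_, ?_, ?_⟩
  · rw [← hT, ← hconj.trace_eq]
  · rw [← hT]; exact htr
  · unfold Osc
    rw [← e]
    exact hG

theorem isDiscreteSplitOscillatorGroup_osc {r : ℕ} (hr : 0 < r)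
    (B : Matrix.SpecialLinearGroup (Fin 2) ℤ) (l : Fin 2 → ℤ) (ht : 2 < B.val.trace)
    (hb : B 0 1 ≠ 0) : IsDiscreteSplitOscillatorGroup (Osc r B l) B.val.trace := by
  refine ⟨r, _, B.val, hr, ?_, isConjHyperbolicRotation_of_trace B.det_coe ht hb, rfl,
    ⟨MulEquiv.refl _⟩⟩
  rw [zpowersHom_apply, toAdd_ofAdd, zpow_one]
  exact DiscHeis.isInducedMatrix_aut hr B l

/-- In `SL₂` a matrix and its inverse have the same trace, so the inverting alternative does no
harm. -/
theorem trace_eq_of_osc_equiv {r r' : ℕ} (hr : 0 < r) (hr' : 0 < r')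
    {A B : Matrix.SpecialLinearGroup (Fin 2) ℤ} (hA : A.val.trace ≠ 2) (hB : B.val.trace ≠ 2)
    {l l' : Fin 2 → ℤ} (F : Osc r A l ≃* Osc r' B l') : A.val.trace = B.val.trace := by
  obtain ⟨-, S, m, hS, ⟨h, -⟩ | ⟨h, -⟩⟩ := conj_of_osc_equiv hr hr' hA hB F
  · exact GLConj.trace_eq ⟨S, hS, h⟩
  · have hinv : S * (A⁻¹).val = B.val * S := by
      conv_lhs => rw [← h]
      rw [mul_assoc, ← Matrix.SpecialLinearGroup.coe_mul, mul_inv_cancel,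
        Matrix.SpecialLinearGroup.coe_one, mul_one]
    rw [← GLConj.trace_eq ⟨S, hS, hinv⟩, Matrix.SpecialLinearGroup.SL2_inv_expl]
    refine Eq.trans ?_ (Matrix.trace_fin_two_of _ _ _ _).symm
    rw [Matrix.trace_fin_two, add_comm]

/-! ### Moving `l` into the table -/

section Equivalences

variable {r : ℕ} {A B : Matrix.SpecialLinearGroup (Fin 2) ℤ} {l l' : Fin 2 → ℤ}

/-- Since `det (S l, S v) = det S * det (l, v)`, the congruences become equalities with `m = 0`. -/
theorem osc_equiv_mulVec {S : Matrix (Fin 2) (Fin 2) ℤ} (hS : S.det * S.det = 1)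
    (h : S * A.val = B.val * S) (l : Fin 2 → ℤ) :
    Nonempty (Osc r A l ≃* Osc r B (S *ᵥ l)) := by
  refine osc_equiv_of_conj S hS h 0 ?_ ?_ <;> rw [Matrix.det_fin_two] <;>
    simp [Matrix.mulVec, dotProduct, Fin.sum_univ_two]
  · exact ⟨0, by ring⟩
  · exact ⟨0, by ring⟩

theorem osc_equiv_trans {G : Type*} [Group G] (h : Nonempty (G ≃* Osc r A l))
    (h' : Nonempty (Osc r A l ≃* Osc r B l')) : Nonempty (G ≃* Osc r B l') :=
  ⟨h.some.trans h'.some⟩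

theorem osc_equiv_translate (m : Fin 2 → ℤ)
    (h0 : (r : ℤ) ∣ (l 1 - l' 1) - (m 0 * (A 0 0 - 1) + m 1 * A 1 0))
    (h1 : (r : ℤ) ∣ (l' 0 - l 0) - (m 0 * A 0 1 + m 1 * (A 1 1 - 1))) :
    Nonempty (Osc r A l ≃* Osc r A l') := by
  refine osc_equiv_of_conj 1 (by simp) (by simp) m ?_ ?_
  · convert h0 using 1; simp; ring
  · convert h1 using 1; simp; ring

theorem osc_equiv_neg : Nonempty (Osc r A l ≃* Osc r A (-l)) := by
  have := osc_equiv_mulVec (r := r) (A := A) (B := A) (S := -1) (by simp [Matrix.det_neg])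
    (by simp) l
  rwa [Matrix.neg_mulVec, Matrix.one_mulVec] at this

/-- The gcd is written through `r % n` so that it evaluates once the residue of `r` is known. -/
theorem exists_bezout (n r : ℕ) {z : ℤ} (h : ((Nat.gcd (r % n) n : ℕ) : ℤ) ∣ z) :
    ∃ x y : ℤ, z = n * x + r * y := by
  rw [← Nat.gcd_rec, Nat.gcd_eq_gcd_ab] at h
  obtain ⟨c, rfl⟩ := h
  exact ⟨_, _, by rw [add_mul, mul_assoc, mul_assoc]⟩

/-- Here `A - 1 = (n n; 1 0)`, so the second coordinate of `l` can be cleared exactly and the first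
matters only modulo `gcd (n, r)`. -/
theorem osc_equiv_companion {n : ℕ} (hA : A.val = !![(n : ℤ) + 1, (n : ℤ); 1, 1]) {k : ℤ}
    (h : ((Nat.gcd (r % n) n : ℕ) : ℤ) ∣ k - l 0) :
    Nonempty (Osc r A l ≃* Osc r A ![k, 0]) := by
  obtain ⟨x, y, e⟩ := exists_bezout n r h
  refine osc_equiv_translate ![x, l 1 - x * n] ?_ ?_ <;> simp [hA]
  exact ⟨y, by linear_combination e⟩

theorem osc_equiv_companion_neg {n : ℕ} (hA : A.val = !![(n : ℤ) + 1, (n : ℤ); 1, 1]) {k : ℤ}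
    (h : ((Nat.gcd (r % n) n : ℕ) : ℤ) ∣ k + l 0) :
    Nonempty (Osc r A l ≃* Osc r A ![k, 0]) := by
  refine osc_equiv_trans osc_equiv_neg (osc_equiv_companion hA ?_)
  simpa using h

/-- Here `A - 1` is twice the unimodular matrix `(2 1; 1 0)`, so each coordinate of `l` matters only
modulo `gcd (2, r)`. -/
theorem osc_equiv_five_two (hA : A.val = !![5, 2; 2, 1])
    (h0 : ((Nat.gcd (r % 2) 2 : ℕ) : ℤ) ∣ l' 0 - l 0)
    (h1 : ((Nat.gcd (r % 2) 2 : ℕ) : ℤ) ∣ l' 1 - l 1) :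
    Nonempty (Osc r A l ≃* Osc r A l') := by
  obtain ⟨x, y, e⟩ := exists_bezout 2 r h0
  obtain ⟨x', y', e'⟩ := exists_bezout 2 r h1
  refine osc_equiv_translate ![x, -x' - 2 * x] ?_ ?_ <;> simp [hA]
  · exact ⟨-y', by push_cast at e'; linear_combination -e'⟩
  · exact ⟨y, by push_cast at e; linear_combination e⟩

/-- The image of `A - 1 = (4 3; 3 1)` has index 5 and is the kernel of `3 l₁ + l₂` modulo 5. -/
theorem osc_equiv_five_three (hA : A.val = !![5, 3; 3, 2])
    (h : ((Nat.gcd (r % 5) 5 : ℕ) : ℤ) ∣ (3 * l' 0 + l' 1) - (3 * l 0 + l 1)) :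
    Nonempty (Osc r A l ≃* Osc r A l') := by
  obtain ⟨x, y, e⟩ := exists_bezout 5 r h
  refine osc_equiv_translate ![x, l' 0 - l 0 - 3 * x] ?_ ?_ <;> simp [hA]
  · exact ⟨-y, by push_cast at e; linear_combination -e⟩
  · exact ⟨0, by ring⟩

theorem exists_inTable_companion_one (hA : A.val = !![2, 1; 1, 1]) (l : Fin 2 → ℤ) :
    ∃ l', InTable r A l' ∧ Nonempty (Osc r A l ≃* Osc r A l') :=
  ⟨![0, 0], Or.inl ⟨hA, rfl⟩, osc_equiv_companion (n := 1) (by simpa using hA) (by simp)⟩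

theorem exists_inTable_companion_two (hA : A.val = !![3, 2; 1, 1]) (l : Fin 2 → ℤ) :
    ∃ l', InTable r A l' ∧ Nonempty (Osc r A l ≃* Osc r A l') := by
  have hA' : A.val = !![((2 : ℕ) : ℤ) + 1, ((2 : ℕ) : ℤ); 1, 1] := by simpa using hA
  have hT : ∀ l', (r % 2 = 0 ∧ (l' = ![0, 0] ∨ l' = ![1, 0]) ∨ r % 2 = 1 ∧ l' = ![0, 0]) →
      InTable r A l' := fun l' h => Or.inr (Or.inl ⟨hA, h⟩)
  rcases Nat.mod_two_eq_zero_or_one r with h | h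
  · rcases Int.emod_two_eq_zero_or_one (l 0) with h' | h'
    · exact ⟨_, hT ![0, 0] (by simp [h]), osc_equiv_companion hA' (by rw [h]; norm_num; omega)⟩
    · exact ⟨_, hT ![1, 0] (by simp [h]), osc_equiv_companion hA' (by rw [h]; norm_num; omega)⟩
  · exact ⟨_, hT ![0, 0] (by simp [h]), osc_equiv_companion hA' (by rw [h]; norm_num)⟩

theorem exists_inTable_companion_three (hA : A.val = !![4, 3; 1, 1]) (l : Fin 2 → ℤ) :
    ∃ l', InTable r A l' ∧ Nonempty (Osc r A l ≃* Osc r A l') := by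
  have hA' : A.val = !![((3 : ℕ) : ℤ) + 1, ((3 : ℕ) : ℤ); 1, 1] := by simpa using hA
  have hT : ∀ l', (r % 3 = 0 ∧ (l' = ![0, 0] ∨ l' = ![1, 0]) ∨ r % 3 ≠ 0 ∧ l' = ![0, 0]) →
      InTable r A l' := fun l' h => Or.inr (Or.inr (Or.inl ⟨hA, h⟩))
  have h3 : r % 3 = 0 ∨ r % 3 = 1 ∨ r % 3 = 2 := by omega
  rcases h3 with h | h | h
  · have : l 0 % 3 = 0 ∨ l 0 % 3 = 1 ∨ l 0 % 3 = 2 := by omega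
    rcases this with h' | h' | h'
    · exact ⟨_, hT ![0, 0] (by simp [h]), osc_equiv_companion hA' (by rw [h]; norm_num; omega)⟩
    · exact ⟨_, hT ![1, 0] (by simp [h]), osc_equiv_companion hA' (by rw [h]; norm_num; omega)⟩
    · exact ⟨_, hT ![1, 0] (by simp [h]),
        osc_equiv_companion_neg hA' (by rw [h]; norm_num; omega)⟩
  all_goals
    exact ⟨_, hT ![0, 0] (by simp [h]), osc_equiv_companion hA' (by rw [h]; norm_num)⟩

theorem exists_inTable_companion_four (hA : A.val = !![5, 4; 1, 1]) (l : Fin 2 → ℤ) :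
    ∃ l', InTable r A l' ∧ Nonempty (Osc r A l ≃* Osc r A l') := by
  have hA' : A.val = !![((4 : ℕ) : ℤ) + 1, ((4 : ℕ) : ℤ); 1, 1] := by simpa using hA
  have hT : ∀ l', (r % 4 = 0 ∧ (l' = ![0, 0] ∨ l' = ![1, 0] ∨ l' = ![2, 0]) ∨
      r % 4 = 2 ∧ (l' = ![0, 0] ∨ l' = ![1, 0]) ∨ r % 2 = 1 ∧ l' = ![0, 0]) →
      InTable r A l' := fun l' h => Or.inr (Or.inr (Or.inr (Or.inl ⟨hA, h⟩)))
  have h4 : r % 4 = 0 ∨ r % 4 = 1 ∨ r % 4 = 2 ∨ r % 4 = 3 := by omega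
  rcases h4 with h | h | h | h
  · have : l 0 % 4 = 0 ∨ l 0 % 4 = 1 ∨ l 0 % 4 = 2 ∨ l 0 % 4 = 3 := by omega
    rcases this with h' | h' | h' | h'
    · exact ⟨_, hT ![0, 0] (by simp [h]), osc_equiv_companion hA' (by rw [h]; norm_num; omega)⟩
    · exact ⟨_, hT ![1, 0] (by simp [h]), osc_equiv_companion hA' (by rw [h]; norm_num; omega)⟩
    · exact ⟨_, hT ![2, 0] (by simp [h]), osc_equiv_companion hA' (by rw [h]; norm_num; omega)⟩
    · exact ⟨_, hT ![1, 0] (by simp [h]),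
        osc_equiv_companion_neg hA' (by rw [h]; norm_num; omega)⟩
  · exact ⟨_, hT ![0, 0] (Or.inr (Or.inr ⟨by omega, rfl⟩)),
      osc_equiv_companion hA' (by rw [h]; norm_num)⟩
  · rcases Int.emod_two_eq_zero_or_one (l 0) with h' | h'
    · exact ⟨_, hT ![0, 0] (by simp [h]), osc_equiv_companion hA' (by rw [h]; norm_num; omega)⟩
    · exact ⟨_, hT ![1, 0] (by simp [h]), osc_equiv_companion hA' (by rw [h]; norm_num; omega)⟩
  · exact ⟨_, hT ![0, 0] (Or.inr (Or.inr ⟨by omega, rfl⟩)),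
      osc_equiv_companion hA' (by rw [h]; norm_num)⟩

theorem exists_inTable_five_two (hA : A.val = !![5, 2; 2, 1]) (l : Fin 2 → ℤ) :
    ∃ l', InTable r A l' ∧ Nonempty (Osc r A l ≃* Osc r A l') := by
  have hT : ∀ l', (r % 2 = 0 ∧ (l' = ![0, 0] ∨ l' = ![1, 0] ∨ l' = ![1, 1]) ∨
      r % 2 = 1 ∧ l' = ![0, 0]) →
      InTable r A l' := fun l' h => Or.inr (Or.inr (Or.inr (Or.inr (Or.inl ⟨hA, h⟩))))
  rcases Nat.mod_two_eq_zero_or_one r with h | h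
  · rcases Int.emod_two_eq_zero_or_one (l 0) with h0 | h0 <;>
      rcases Int.emod_two_eq_zero_or_one (l 1) with h1 | h1
    · exact ⟨_, hT ![0, 0] (by simp [h]),
        osc_equiv_five_two hA (by rw [h]; norm_num; omega) (by rw [h]; norm_num; omega)⟩
    · refine ⟨_, hT ![1, 0] (by simp [h]), ?_⟩
      -- The matrix `(2 1; 1 0)` is a square root of `A`; modulo 2 it swaps the coordinates.
      refine osc_equiv_trans (osc_equiv_mulVec (S := !![2, 1; 1, 0]) (B := A) ?_ ?_ l)
        (osc_equiv_five_two hA ?_ ?_)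
      · simp [Matrix.det_fin_two_of]
      · rw [hA]; simp
      · rw [h]; simp [Matrix.mulVec, dotProduct, Fin.sum_univ_two]; omega
      · rw [h]; simp [Matrix.mulVec, dotProduct, Fin.sum_univ_two]; omega
    · exact ⟨_, hT ![1, 0] (by simp [h]),
        osc_equiv_five_two hA (by rw [h]; norm_num; omega) (by rw [h]; norm_num; omega)⟩
    · exact ⟨_, hT ![1, 1] (by simp [h]),
        osc_equiv_five_two hA (by rw [h]; norm_num; omega) (by rw [h]; norm_num; omega)⟩
  · exact ⟨_, hT ![0, 0] (by simp [h]),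
      osc_equiv_five_two hA (by rw [h]; norm_num) (by rw [h]; norm_num)⟩

theorem exists_inTable_companion_five (hA : A.val = !![6, 5; 1, 1]) (l : Fin 2 → ℤ) :
    ∃ l', InTable r A l' ∧ Nonempty (Osc r A l ≃* Osc r A l') := by
  have hA' : A.val = !![((5 : ℕ) : ℤ) + 1, ((5 : ℕ) : ℤ); 1, 1] := by simpa using hA
  have hT : ∀ l', (r % 5 = 0 ∧ (l' = ![0, 0] ∨ l' = ![1, 0] ∨ l' = ![2, 0]) ∨
      r % 5 ≠ 0 ∧ l' = ![0, 0]) →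
      InTable r A l' := fun l' h => Or.inr (Or.inr (Or.inr (Or.inr (Or.inr (Or.inl ⟨hA, h⟩)))))
  have h5 : r % 5 = 0 ∨ r % 5 = 1 ∨ r % 5 = 2 ∨ r % 5 = 3 ∨ r % 5 = 4 := by omega
  rcases h5 with h | h | h | h | h
  · have : l 0 % 5 = 0 ∨ l 0 % 5 = 1 ∨ l 0 % 5 = 2 ∨ l 0 % 5 = 3 ∨ l 0 % 5 = 4 := by omega
    rcases this with h' | h' | h' | h' | h'
    · exact ⟨_, hT ![0, 0] (by simp [h]), osc_equiv_companion hA' (by rw [h]; norm_num; omega)⟩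
    · exact ⟨_, hT ![1, 0] (by simp [h]), osc_equiv_companion hA' (by rw [h]; norm_num; omega)⟩
    · exact ⟨_, hT ![2, 0] (by simp [h]), osc_equiv_companion hA' (by rw [h]; norm_num; omega)⟩
    · exact ⟨_, hT ![2, 0] (by simp [h]),
        osc_equiv_companion_neg hA' (by rw [h]; norm_num; omega)⟩
    · exact ⟨_, hT ![1, 0] (by simp [h]),
        osc_equiv_companion_neg hA' (by rw [h]; norm_num; omega)⟩
  all_goals
    exact ⟨_, hT ![0, 0] (by simp [h]), osc_equiv_companion hA' (by rw [h]; norm_num)⟩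

theorem exists_inTable_five_three (hA : A.val = !![5, 3; 3, 2]) (l : Fin 2 → ℤ) :
    ∃ l', InTable r A l' ∧ Nonempty (Osc r A l ≃* Osc r A l') := by
  have hT : ∀ l', (r % 5 = 0 ∧ (l' = ![0, 0] ∨ l' = ![0, 1]) ∨ r % 5 ≠ 0 ∧ l' = ![0, 0]) →
      InTable r A l' := fun l' h => Or.inr (Or.inr (Or.inr (Or.inr (Or.inr (Or.inr ⟨hA, h⟩)))))
  have h5 : r % 5 = 0 ∨ r % 5 = 1 ∨ r % 5 = 2 ∨ r % 5 = 3 ∨ r % 5 = 4 := by omega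
  -- The matrix `(1 1; 1 0)` is a fourth root of `A`. It multiplies `3 l₁ + l₂` by 3 modulo 5, and 3
  -- generates the units, so all nonzero classes merge.
  have step : ∀ l : Fin 2 → ℤ, Nonempty (Osc r A l ≃* Osc r A (!![1, 1; 1, 0] *ᵥ l)) := fun l =>
    osc_equiv_mulVec (by simp [Matrix.det_fin_two_of]) (by rw [hA]; simp) l
  rcases h5 with h | h | h | h | h
  · have : (3 * l 0 + l 1) % 5 = 0 ∨ (3 * l 0 + l 1) % 5 = 1 ∨ (3 * l 0 + l 1) % 5 = 2 ∨
        (3 * l 0 + l 1) % 5 = 3 ∨ (3 * l 0 + l 1) % 5 = 4 := by omega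
    rcases this with h' | h' | h' | h' | h'
    · exact ⟨_, hT ![0, 0] (by simp [h]), osc_equiv_five_three hA (by rw [h]; simp; omega)⟩
    · exact ⟨_, hT ![0, 1] (by simp [h]), osc_equiv_five_three hA (by rw [h]; simp; omega)⟩
    · refine ⟨_, hT ![0, 1] (by simp [h]), osc_equiv_trans (step _)
        (osc_equiv_five_three hA ?_)⟩
      rw [h]; simp [Matrix.mulVec, dotProduct, Fin.sum_univ_two]; omega
    · refine ⟨_, hT ![0, 1] (by simp [h]), osc_equiv_trans (osc_equiv_trans (osc_equiv_trans
        (step _) (step _)) (step _)) (osc_equiv_five_three hA ?_)⟩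
      rw [h]; simp [Matrix.mulVec, dotProduct, Fin.sum_univ_two]; omega
    · refine ⟨_, hT ![0, 1] (by simp [h]), osc_equiv_trans (osc_equiv_trans
        (step _) (step _)) (osc_equiv_five_three hA ?_)⟩
      rw [h]; simp [Matrix.mulVec, dotProduct, Fin.sum_univ_two]; omega
  all_goals
    exact ⟨_, hT ![0, 0] (by simp [h]), osc_equiv_five_three hA (by rw [h]; norm_num)⟩

end Equivalences

theorem exists_inTable_of_trace_le {r : ℕ} (A : Matrix.SpecialLinearGroup (Fin 2) ℤ)
    (l : Fin 2 → ℤ) (hT : 2 < A.val.trace) (hT7 : A.val.trace ≤ 7) :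
    ∃ (B : Matrix.SpecialLinearGroup (Fin 2) ℤ) (l' : Fin 2 → ℤ),
      InTable r B l' ∧ Nonempty (Osc r A l ≃* Osc r B l') := by
  have key : ∀ B : Matrix (Fin 2) (Fin 2) ℤ, GLConj A.val B →
      (∀ B' : Matrix.SpecialLinearGroup (Fin 2) ℤ, B'.val = B → ∀ l : Fin 2 → ℤ,
        ∃ l', InTable r B' l' ∧ Nonempty (Osc r B' l ≃* Osc r B' l')) →
      ∃ (B : Matrix.SpecialLinearGroup (Fin 2) ℤ) (l' : Fin 2 → ℤ),
        InTable r B l' ∧ Nonempty (Osc r A l ≃* Osc r B l') := by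
    intro B hB h
    let B' : Matrix.SpecialLinearGroup (Fin 2) ℤ := ⟨B, hB.det_eq.symm.trans A.det_coe⟩
    obtain ⟨S, hS, hSB⟩ := hB
    obtain ⟨l', h1, h2⟩ := h B' rfl (S *ᵥ l)
    exact ⟨B', l', h1, osc_equiv_trans (osc_equiv_mulVec hS hSB l) h2⟩
  rcases GLConj.exists_representative A.val A.det_coe hT hT7 with h | h | h | h | h | h | h
  · exact key _ h fun _ => exists_inTable_companion_one
  · exact key _ h fun _ => exists_inTable_companion_two
  · exact key _ h fun _ => exists_inTable_companion_three
  · exact key _ h fun _ => exists_inTable_companion_four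
  · exact key _ h fun _ => exists_inTable_five_two
  · exact key _ h fun _ => exists_inTable_companion_five
  · exact key _ h fun _ => exists_inTable_five_three

/-! ### Separating the entries of the table -/

section Invariants

variable {r : ℕ} {A B : Matrix.SpecialLinearGroup (Fin 2) ℤ} {l l' : Fin 2 → ℤ}

/-- The conclusion of `conj_of_osc_equiv` in terms of the entries of the matrices. -/
theorem entries_of_osc_equiv (hr : 0 < r) {a b c d a' b' c' d' : ℤ}
    (hA : A.val = !![a, b; c, d]) (hB : B.val = !![a', b'; c', d'])
    (htA : a + d ≠ 2) (htB : a' + d' ≠ 2) (F : Osc r A l ≃* Osc r B l') :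
    ∃ p q s t m n : ℤ, (p * t - q * s = 1 ∨ p * t - q * s = -1) ∧
      ((p * a + q * c = a' * p + b' * s ∧ p * b + q * d = a' * q + b' * t ∧
        s * a + t * c = c' * p + d' * s ∧ s * b + t * d = c' * q + d' * t ∧
        (r : ℤ) ∣ (-l' 1 * p + l' 0 * s) -
          ((p * t - q * s) * (-l 1) + (m * (a - 1) + n * c)) ∧
        (r : ℤ) ∣ (-l' 1 * q + l' 0 * t) - ((p * t - q * s) * l 0 + (m * b + n * (d - 1)))) ∨
      (p * d - q * c = a' * p + b' * s ∧ q * a - p * b = a' * q + b' * t ∧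
        s * d - t * c = c' * p + d' * s ∧ t * a - s * b = c' * q + d' * t ∧
        (r : ℤ) ∣ (-l' 1 * (p * a + q * c) + l' 0 * (s * a + t * c)) +
          ((p * t - q * s) * (-l 1) + (m * (a - 1) + n * c)) ∧
        (r : ℤ) ∣ (-l' 1 * (p * b + q * d) + l' 0 * (s * b + t * d)) +
          ((p * t - q * s) * l 0 + (m * b + n * (d - 1))))) := by
  have htA' : A.val.trace ≠ 2 := by rwa [hA, Matrix.trace_fin_two_of]
  have htB' : B.val.trace ≠ 2 := by rwa [hB, Matrix.trace_fin_two_of]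
  obtain ⟨-, S, m, hS, h⟩ := conj_of_osc_equiv hr hr htA' htB' F
  obtain ⟨p, q, s, t, rfl⟩ : ∃ p q s t, S = !![p, q; s, t] :=
    ⟨_, _, _, _, Matrix.eta_fin_two S⟩
  have hD := Int.isUnit_iff.1 (IsUnit.of_mul_eq_one_right _ hS)
  have hdet := A.det_coe
  rw [hA, Matrix.det_fin_two_of] at hdet
  rw [Matrix.det_fin_two_of] at hD h
  rw [hA, hB] at h
  simp only [Matrix.mul_fin_two] at h
  refine ⟨p, q, s, t, m 0, m 1, hD, h.imp ?_ ?_⟩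
  · rintro ⟨h, h0, h1⟩
    refine ⟨congrFun (congrFun h 0) 0, congrFun (congrFun h 0) 1, congrFun (congrFun h 1) 0,
      congrFun (congrFun h 1) 1, h0, h1⟩
  · rintro ⟨h, h0, h1⟩
    have e00 : (a' * p + b' * s) * a + (a' * q + b' * t) * c = p := congrFun (congrFun h 0) 0
    have e01 : (a' * p + b' * s) * b + (a' * q + b' * t) * d = q := congrFun (congrFun h 0) 1
    have e10 : (c' * p + d' * s) * a + (c' * q + d' * t) * c = s := congrFun (congrFun h 1) 0
    have e11 : (c' * p + d' * s) * b + (c' * q + d' * t) * d = t := congrFun (congrFun h 1) 1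
    -- Multiplying by the adjugate of `A` turns `B S A = S` into `S A⁻¹ = B S`, which is linear in
    -- the entries of `S`.
    refine ⟨?_, ?_, ?_, ?_, h0, h1⟩
    · linear_combination (-d) * e00 + c * e01 + (a' * p + b' * s) * hdet
    · linear_combination b * e00 - a * e01 + (a' * q + b' * t) * hdet
    · linear_combination (-d) * e10 + c * e11 + (c' * p + d' * s) * hdet
    · linear_combination b * e10 - a * e11 + (c' * q + d' * t) * hdet

/-- The relation `S A = A^{±1} S` expresses `S` through its second row `(s, t)`, and `±det S`
becomes the quadratic form on the right. Modulo a common divisor of `n` and `r`, the congruence for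
`β` loses `m` and reads `l'₁ t = e l₁`. -/
theorem companion_invariant (hr : 0 < r) {n : ℤ} (hn : 0 < n)
    (hA : A.val = !![n + 1, n; 1, 1]) (F : Osc r A l ≃* Osc r A l') :
    ∃ s t e : ℤ, (e = 1 ∨ e = -1) ∧ e = t ^ 2 + n * s * t - n * s ^ 2 ∧
      ∀ g : ℤ, g ∣ n → g ∣ r → g ∣ l' 0 * t - e * l 0 := by
  obtain ⟨p, q, s, t, m, k, hD, h⟩ :=
    entries_of_osc_equiv hr hA hA (by omega) (by omega) F
  rcases h with ⟨e1, e2, e3, e4, -, h1⟩ | ⟨e1, e2, e3, e4, -, h1⟩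
  · have hq : q = n * s := by linarith
    have hp : p = n * s + t := by linarith
    refine ⟨s, t, p * t - q * s, hD, by rw [hp, hq]; ring, fun g hgn hgr => ?_⟩
    refine (dvd_add (hgr.trans h1) (hgn.mul_right (l' 1 * s + m))).trans (Eq.dvd ?_)
    rw [hq]; ring
  · have hp : p = -t := by linarith
    have hq : q = n * t - n * s := by rw [hp] at e1; linarith
    refine ⟨s, t, -(p * t - q * s), by omega, by rw [hp, hq]; ring, fun g hgn hgr => ?_⟩
    refine (dvd_add (hgr.trans h1) (hgn.mul_right (-l' 1 * s - l' 0 * s - m))).trans (Eq.dvd ?_)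
    rw [hp, hq]; ring

theorem companion_two_injective (hr : 0 < r) (hA : A.val = !![3, 2; 1, 1]) (h2 : r % 2 = 0)
    (hl : l = ![0, 0] ∨ l = ![1, 0]) (hl' : l' = ![0, 0] ∨ l' = ![1, 0])
    (F : Osc r A l ≃* Osc r A l') : l = l' := by
  obtain ⟨s, t, e, he, hst, h⟩ := companion_invariant hr (n := 2) (by norm_num) hA F
  have hg := h 2 dvd_rfl (by omega)
  have ht : t % 2 = 1 := by
    rcases Int.emod_two_eq_zero_or_one t with h0 | h0
    · obtain ⟨u, rfl⟩ := Int.dvd_of_emod_eq_zero h0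
      have : e = 2 * (2 * u ^ 2 + 2 * s * u - s ^ 2) := by rw [hst]; ring
      omega
    · exact h0
  clear h hst F
  rcases hl with rfl | rfl <;> rcases hl' with rfl | rfl <;>
    first | rfl | (exfalso; simp at hg; omega)

theorem companion_three_injective (hr : 0 < r) (hA : A.val = !![4, 3; 1, 1]) (h3 : r % 3 = 0)
    (hl : l = ![0, 0] ∨ l = ![1, 0]) (hl' : l' = ![0, 0] ∨ l' = ![1, 0])
    (F : Osc r A l ≃* Osc r A l') : l = l' := by
  obtain ⟨s, t, e, he, hst, h⟩ := companion_invariant hr (n := 3) (by norm_num) hA F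
  have hg := h 3 dvd_rfl (by omega)
  have ht : ¬ (3 : ℤ) ∣ t := by
    rintro ⟨u, rfl⟩
    have : e = 3 * (3 * u ^ 2 + 3 * s * u - s ^ 2) := by rw [hst]; ring
    omega
  clear h hst F
  rcases hl with rfl | rfl <;> rcases hl' with rfl | rfl <;>
    first | rfl | (exfalso; simp at hg; omega)

/-- Modulo 4 the factor `t` is a unit, so the classes `0`, `±1`, `2` of `l₁` are separated when `4 ∣
r`; when `r` is `2` modulo 4, its parity is what survives. -/
theorem companion_four_injective (hr : 0 < r) (hA : A.val = !![5, 4; 1, 1])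
    (hl : r % 4 = 0 ∧ (l = ![0, 0] ∨ l = ![1, 0] ∨ l = ![2, 0]) ∨
      r % 4 = 2 ∧ (l = ![0, 0] ∨ l = ![1, 0]) ∨ r % 2 = 1 ∧ l = ![0, 0])
    (hl' : r % 4 = 0 ∧ (l' = ![0, 0] ∨ l' = ![1, 0] ∨ l' = ![2, 0]) ∨
      r % 4 = 2 ∧ (l' = ![0, 0] ∨ l' = ![1, 0]) ∨ r % 2 = 1 ∧ l' = ![0, 0])
    (F : Osc r A l ≃* Osc r A l') : l = l' := by
  obtain ⟨s, t, e, he, hst, h⟩ := companion_invariant hr (n := 4) (by norm_num) hA F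
  have ht : t % 2 = 1 := by
    rcases Int.emod_two_eq_zero_or_one t with h0 | h0
    · obtain ⟨u, rfl⟩ := Int.dvd_of_emod_eq_zero h0
      have : e = 2 * (2 * u ^ 2 + 4 * s * u - 2 * s ^ 2) := by rw [hst]; ring
      omega
    · exact h0
  have hg4 := h 4 dvd_rfl
  have hg2 := h 2 (by norm_num)
  clear h hst F
  rcases hl with ⟨hr4, rfl | rfl | rfl⟩ | ⟨hr4, rfl | rfl⟩ | ⟨hr4, rfl⟩ <;>
    rcases hl' with ⟨hr4', rfl | rfl | rfl⟩ | ⟨hr4', rfl | rfl⟩ | ⟨hr4', rfl⟩ <;>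
    first
    | rfl
    | (exfalso; omega)
    | (exfalso; have hg := hg4 (by omega); simp at hg; omega)
    | (exfalso; have hg := hg2 (by omega); simp at hg; omega)

/-- Five is the first case where units need care: the norm equation with `e = 1` gives `t² = 1`
modulo 5, so `l₁` is determined up to sign. The value `e = -1` would allow `t = ±2` and merge the
classes of `1` and `2`. -/
theorem companion_five_injective (hr : 0 < r) (hA : A.val = !![6, 5; 1, 1]) (h5 : r % 5 = 0)
    (hl : l = ![0, 0] ∨ l = ![1, 0] ∨ l = ![2, 0])
    (hl' : l' = ![0, 0] ∨ l' = ![1, 0] ∨ l' = ![2, 0])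
    (F : Osc r A l ≃* Osc r A l') : l = l' := by
  obtain ⟨s, t, e, he, hst, h⟩ := companion_invariant hr (n := 5) (by norm_num) hA F
  have hg := h 5 dvd_rfl (by omega)
  -- `-1` is not a square modulo three
  have he1 : e = 1 := by
    refine he.resolve_right fun he => ?_
    have : (t + s) ^ 2 + 1 = 3 * (2 * s ^ 2 - s * t) := by linear_combination he - hst
    have h3 : (t + s) % 3 = 0 ∨ (t + s) % 3 = 1 ∨ (t + s) % 3 = 2 := by omega
    generalize 2 * s ^ 2 - s * t = w at this
    generalize t + s = v at this h3
    have hv := Int.emod_add_mul_ediv v 3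
    generalize v / 3 = u at hv
    rcases h3 with h | h | h <;> rw [h] at hv <;> subst hv <;> ring_nf at this <;> omega
  have ht : t % 5 = 1 ∨ t % 5 = 4 := by
    have : t ^ 2 - 1 = 5 * (s ^ 2 - s * t) := by linear_combination he1 - hst
    have h5 : t % 5 = 0 ∨ t % 5 = 1 ∨ t % 5 = 2 ∨ t % 5 = 3 ∨ t % 5 = 4 := by omega
    generalize s ^ 2 - s * t = w at this
    have hv := Int.emod_add_mul_ediv t 5
    generalize t / 5 = u at hv
    rcases h5 with h | h | h | h | h <;> rw [h] at hv ⊢ <;> first | omega | skip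
    all_goals
      rw [← hv] at this
      ring_nf at this
      omega
  clear h hst F
  subst he1
  rcases hl with rfl | rfl | rfl <;> rcases hl' with rfl | rfl | rfl <;>
    first | rfl | (exfalso; simp at hg <;> omega)

/-- Modulo 2 the matrix `S` is the identity or the swap, while the translation term vanishes; the
orbits are those of `(0,0)`, `(1,0)` and `(1,1)`. -/
theorem five_two_injective (hr : 0 < r) (hA : A.val = !![5, 2; 2, 1]) (h2 : r % 2 = 0)
    (hl : l = ![0, 0] ∨ l = ![1, 0] ∨ l = ![1, 1])
    (hl' : l' = ![0, 0] ∨ l' = ![1, 0] ∨ l' = ![1, 1])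
    (F : Osc r A l ≃* Osc r A l') : l = l' := by
  obtain ⟨p, q, s, t, m, k, hD, h⟩ :=
    entries_of_osc_equiv hr hA hA (by omega) (by omega) F
  have hr2 : (2 : ℤ) ∣ r := by omega
  have key : p % 2 = t % 2 ∧ q % 2 = s % 2 ∧ (s + t) % 2 = 1 ∧
      (2 : ℤ) ∣ (-l' 1 * p + l' 0 * s) - l 1 ∧ (2 : ℤ) ∣ (-l' 1 * q + l' 0 * t) - l 0 := by
    have hpar : p % 2 = t % 2 → q % 2 = s % 2 → (s + t) % 2 = 1 := by
      intro hpt hqs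
      rcases Int.emod_two_eq_zero_or_one (s + t) with h0 | h0
      · obtain ⟨u, hu⟩ : ∃ u, p = t + 2 * u := ⟨(p - t) / 2, by omega⟩
        obtain ⟨v, hv⟩ : ∃ v, q = s + 2 * v := ⟨(q - s) / 2, by omega⟩
        obtain ⟨w, hw⟩ : ∃ w, t = 2 * w - s := ⟨(s + t) / 2, by omega⟩
        have : p * t - q * s = 2 * (2 * w ^ 2 - 2 * w * s + u * t - v * s) := by
          rw [hu, hv, hw]; ring
        omega
      · exact h0
    rcases h with ⟨e1, e2, e3, e4, h0, h1⟩ | ⟨e1, e2, e3, e4, h0, h1⟩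
    · have hpt : p % 2 = t % 2 := by omega
      have hqs : q % 2 = s % 2 := by omega
      refine ⟨hpt, hqs, hpar hpt hqs, ?_, ?_⟩
      · have := hr2.trans h0
        rcases hD with hD | hD <;> rw [hD] at this <;> omega
      · have := hr2.trans h1
        rcases hD with hD | hD <;> rw [hD] at this <;> omega
    · have hpt : p % 2 = t % 2 := by omega
      have hqs : q % 2 = s % 2 := by omega
      refine ⟨hpt, hqs, hpar hpt hqs, ?_, ?_⟩
      · obtain ⟨w, hw⟩ := hr2.trans h0
        rcases hD with hD | hD <;> rw [hD] at hw
        · exact ⟨w + l' 1 * (2 * p + q) - l' 0 * (2 * s + t) - 2 * m - k, by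
            linear_combination hw⟩
        · exact ⟨w + l' 1 * (2 * p + q) - l' 0 * (2 * s + t) - 2 * m - k - l 1, by
            linear_combination hw⟩
      · obtain ⟨w, hw⟩ := hr2.trans h1
        rcases hD with hD | hD <;> rw [hD] at hw
        · exact ⟨w + l' 1 * p - l' 0 * s - m - l 0, by linear_combination hw⟩
        · exact ⟨w + l' 1 * p - l' 0 * s - m, by linear_combination hw⟩
  obtain ⟨hpt, hqs, hst, h0, h1⟩ := key
  clear h F hD
  rcases hl with rfl | rfl | rfl <;> rcases hl' with rfl | rfl | rfl <;>
    first | rfl | (exfalso; simp at h0 h1 <;> omega)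

/-- If `(0,1)` were equivalent to zero, the first row of `S` would satisfy `p = 3 q` modulo 5.
Together with `S A = A^{±1} S` this forces `5 ∣ det S`. -/
theorem five_three_not_equiv (hr : 0 < r) (hA : A.val = !![5, 3; 3, 2]) (h5 : r % 5 = 0)
    (F : Osc r A ![0, 0] ≃* Osc r A ![0, 1]) : False := by
  obtain ⟨p, q, s, t, m, k, hD, h⟩ :=
    entries_of_osc_equiv hr hA hA (by omega) (by omega) F
  have hr5 : (5 : ℤ) ∣ r := by omega
  rcases h with ⟨e1, e2, e3, e4, h0, h1⟩ | ⟨e1, e2, e3, e4, h0, h1⟩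
  · have h0 := hr5.trans h0
    have h1 := hr5.trans h1
    simp at h0 h1
    obtain ⟨w, hw⟩ : ∃ w, t = 2 * s + 5 * w := ⟨(t - 2 * s) / 5, by omega⟩
    have hp : p = 3 * s + 5 * w := by omega
    have hq : q = s := by omega
    have : p * t - q * s = 5 * (s ^ 2 + 5 * s * w + 5 * w ^ 2) := by
      rw [hp, hq, hw]; ring
    omega
  · have h0 := hr5.trans h0
    have h1 := hr5.trans h1
    simp at h0 h1
    have ht : t = -p := by omega
    have hq : q = -p - s := by omega
    obtain ⟨w, hw⟩ : ∃ w, s = 2 * p + 5 * w := ⟨(s - 2 * p) / 5, by omega⟩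
    have : p * t - q * s = 5 * (p ^ 2 + 5 * p * w + 5 * w ^ 2) := by
      rw [ht, hq, hw]; ring
    omega

/-- Modulo 2 the matrix `B` is the identity and `A` is not; this forces the second column of `S` to
be even. -/
theorem not_equiv_of_trace_six (hr : 0 < r) (hA : A.val = !![5, 4; 1, 1])
    (hB : B.val = !![5, 2; 2, 1]) (F : Osc r A l ≃* Osc r B l') : False := by
  obtain ⟨p, q, s, t, m, k, hD, h⟩ :=
    entries_of_osc_equiv hr hA hB (by omega) (by omega) F
  have hqt : q % 2 = 0 ∧ t % 2 = 0 := by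
    rcases h with ⟨e1, e2, e3, e4, -⟩ | ⟨e1, e2, e3, e4, -⟩ <;> constructor <;> omega
  obtain ⟨u, rfl⟩ := Int.dvd_of_emod_eq_zero hqt.1
  obtain ⟨v, rfl⟩ := Int.dvd_of_emod_eq_zero hqt.2
  have : p * (2 * v) - 2 * u * s = 2 * (p * v - u * s) := by ring
  omega

/-- Modulo 3 the matrix `B` is `-1` and `A` is not, so `S` would be singular modulo 3. -/
theorem not_equiv_of_trace_seven (hr : 0 < r) (hA : A.val = !![6, 5; 1, 1])
    (hB : B.val = !![5, 3; 3, 2]) (F : Osc r A l ≃* Osc r B l') : False := by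
  obtain ⟨p, q, s, t, m, k, hD, h⟩ :=
    entries_of_osc_equiv hr hA hB (by omega) (by omega) F
  rcases h with ⟨e1, e2, e3, e4, -⟩ | ⟨e1, e2, e3, e4, -⟩
  · have hq : q = 3 * s - p := by omega
    have ht : t = 3 * p - 4 * s := by omega
    have : p * t - q * s = 3 * (p ^ 2 - p * s - s ^ 2) := by rw [hq, ht]; ring
    omega
  · have hq : q = -4 * p - 3 * s := by omega
    have ht : t = -3 * p - s := by omega
    have : p * t - q * s = 3 * (-p ^ 2 + p * s + s ^ 2) := by rw [hq, ht]; ring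
    omega

end Invariants

/-! ### Assembling the classification -/

theorem InTable.trace_bounds {r : ℕ} {B : Matrix.SpecialLinearGroup (Fin 2) ℤ} {l : Fin 2 → ℤ}
    (h : InTable r B l) : 2 < B.val.trace ∧ B.val.trace ≤ 7 ∧ B 0 1 ≠ 0 := by
  rcases h with ⟨h, -⟩ | ⟨h, -⟩ | ⟨h, -⟩ | ⟨h, -⟩ | ⟨h, -⟩ | ⟨h, -⟩ | ⟨h, -⟩ <;> rw [h] <;>
    simp [Matrix.trace_fin_two_of]

theorem InTable.injective {r : ℕ} (hr : 0 < r) {A B : Matrix.SpecialLinearGroup (Fin 2) ℤ}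
    {l l' : Fin 2 → ℤ} (h : InTable r A l) (h' : InTable r B l') (F : Osc r A l ≃* Osc r B l') :
    A = B ∧ l = l' := by
  have ht := trace_eq_of_osc_equiv hr hr h.trace_bounds.1.ne' h'.trace_bounds.1.ne' F
  rcases h with ⟨h, hl⟩ | ⟨h, hl⟩ | ⟨h, hl⟩ | ⟨h, hl⟩ | ⟨h, hl⟩ | ⟨h, hl⟩ | ⟨h, hl⟩ <;>
    rcases h' with ⟨h', hl'⟩ | ⟨h', hl'⟩ | ⟨h', hl'⟩ | ⟨h', hl'⟩ | ⟨h', hl'⟩ | ⟨h', hl'⟩ |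
      ⟨h', hl'⟩ <;>
    rw [h, h'] at ht <;> simp only [Matrix.trace_fin_two_of] at ht <;>
    -- The trace separates all pairs of different matrices except those of trace 6 and trace 7. On
    -- the diagonal it remains to compare `l` and `l'`.
    first
    | (exfalso; omega)
    | exact (not_equiv_of_trace_six hr h h' F).elim
    | exact (not_equiv_of_trace_six hr h' h F.symm).elim
    | exact (not_equiv_of_trace_seven hr h h' F).elim
    | exact (not_equiv_of_trace_seven hr h' h F.symm).elim
    | obtain rfl : A = B := Subtype.ext (h.trans h'.symm)
      refine ⟨rfl, ?_⟩
  · rw [hl, hl']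
  · rcases hl with ⟨h2, hl⟩ | ⟨h2, hl⟩ <;> rcases hl' with ⟨h2', hl'⟩ | ⟨h2', hl'⟩
    · exact companion_two_injective hr h h2 hl hl' F
    · omega
    · omega
    · rw [hl, hl']
  · rcases hl with ⟨h2, hl⟩ | ⟨h2, hl⟩ <;> rcases hl' with ⟨h2', hl'⟩ | ⟨h2', hl'⟩
    · exact companion_three_injective hr h h2 hl hl' F
    · omega
    · omega
    · rw [hl, hl']
  · exact companion_four_injective hr h hl hl' F
  · rcases hl with ⟨h2, hl⟩ | ⟨h2, hl⟩ <;> rcases hl' with ⟨h2', hl'⟩ | ⟨h2', hl'⟩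
    · exact five_two_injective hr h h2 hl hl' F
    · omega
    · omega
    · rw [hl, hl']
  · rcases hl with ⟨h2, hl⟩ | ⟨h2, hl⟩ <;> rcases hl' with ⟨h2', hl'⟩ | ⟨h2', hl'⟩
    · exact companion_five_injective hr h h2 hl hl' F
    · omega
    · omega
    · rw [hl, hl']
  · rcases hl with ⟨h2, hl⟩ | ⟨h2, hl⟩ <;> rcases hl' with ⟨h2', hl'⟩ | ⟨h2', hl'⟩
    · rcases hl with rfl | rfl <;> rcases hl' with rfl | rfl
      · rfl
      · exact (five_three_not_equiv hr h h2 F).elim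
      · exact (five_three_not_equiv hr h h2 F.symm).elim
      · rfl
    · omega
    · omega
    · rw [hl, hl']

theorem mainTheorem6 :
    (∀ (G G' : Type*) [Group G] [Group G'] (T T' : ℤ),
      IsDiscreteSplitOscillatorGroup G T → IsDiscreteSplitOscillatorGroup G' T' →
        Nonempty (G ≃* G') → T = T') ∧
    (∀ (r : ℕ) (B : Matrix.SpecialLinearGroup (Fin 2) ℤ) (l : Fin 2 → ℤ), 0 < r → InTable r B l →
      IsDiscreteSplitOscillatorGroup (Osc r B l) B.val.trace ∧ B.val.trace ≤ 7) ∧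
    (∀ (G : Type*) [Group G] (T : ℤ), IsDiscreteSplitOscillatorGroup G T → T ≤ 7 →
      ∃ (r : ℕ) (B : Matrix.SpecialLinearGroup (Fin 2) ℤ) (l : Fin 2 → ℤ),
        0 < r ∧ InTable r B l ∧ Nonempty (G ≃* Osc r B l)) ∧
    (∀ (r r' : ℕ) (B B' : Matrix.SpecialLinearGroup (Fin 2) ℤ) (l l' : Fin 2 → ℤ),
      0 < r → 0 < r' → InTable r B l → InTable r' B' l' →
        Nonempty (Osc r B l ≃* Osc r' B' l') → r = r' ∧ B = B' ∧ l = l') := by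
  refine ⟨?_, ?_, ?_, ?_⟩
  · intro G G' _ _ T T' h h' ⟨F⟩
    obtain ⟨r, A, l, hr, hA, hT, ⟨e⟩⟩ := h.exists_osc
    obtain ⟨r', A', l', hr', hA', hT', ⟨e'⟩⟩ := h'.exists_osc
    rw [← hA, ← hA']
    exact trace_eq_of_osc_equiv hr hr' (by omega) (by omega) ((e.symm.trans F).trans e')
  · intro r B l hr h
    obtain ⟨h2, h7, hb⟩ := h.trace_bounds
    exact ⟨isDiscreteSplitOscillatorGroup_osc hr B l h2 hb, h7⟩
  · intro G _ T h hT
    obtain ⟨r, A, l, hr, hA, h2, e⟩ := h.exists_osc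
    obtain ⟨B, l', hB, F⟩ :=
      exists_inTable_of_trace_le (r := r) A l (by omega) (by omega)
    exact ⟨r, B, l', hr, hB, osc_equiv_trans e F⟩
  · intro r r' B B' l l' hr hr' h h' ⟨F⟩
    obtain ⟨rfl, -⟩ :=
      conj_of_osc_equiv hr hr' h.trace_bounds.1.ne' h'.trace_bounds.1.ne' F
    exact ⟨rfl, h.injective hr h' F⟩
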